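/- Let $P(4)=\mathbb P(\mathrm{Sym}^4\mathbb C^2)\cong\mathbb P^4$ be the projective space of binary quartics over $\mathbb C$, with homogeneous coordinates $a_0,\dots,a_4$ given by $F=\sum_{i=0}^4\binom4i a_i\,t_0^{4-i}t_1^i$, and let $PGL(2,\mathbb C)$ act on it by linear substitutions of $t_0,t_1$. Put $$Q=a_0a_4-4a_1a_3+3a_2^2,\qquad C=a_0a_2a_4-a_0a_3^2+2a_1a_2a_3-a_1^2a_4-a_2^3,$$ $$\omega=2\,Q\,dC-3\,C\,dQ .$$ Then the following hold. (1) $\omega$ is a nonzero integrable 1-form on $P(4)$ of degree $3$: its coefficients are homogeneous of degree $4$, its contraction with the radial vector field is zero (so $\omega\in H^0(\mathbb P^4,\Omega^1(5))$), and $\omega\wedge d\omega=0$. (2) $\omega$ defines the foliation by $PGL(2,\mathbb C)$-orbits: at every point $x\in P(4)$ where $\omega$ does not vanish, the kernel of $\omega$ is the tangent space of the orbit of $x$ (on $\mathbb C^5$: the tangent space of the $GL(2,\mathbb C)$-orbit of a representative of $x$), and the leaf of $\omega$ through $x$, i.e. the set of points that can be joined to $x$ by a $C^1$ curve that avoids the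 zeros of $\omega$ and is tangent to $\ker\omega$, is the orbit of $x$. (3) Let $\bar T$ be the tangential surface of the Veronese curve $\{[\ell^4]\}\subset P(4)$, i.e. the union of its tangent lines, and let $N$ be the set of quartics with two distinct double roots. Then $N$ is a single $PGL(2,\mathbb C)$-orbit, and the zero set of $\omega$ in $P(4)$ is $S(\omega)=\bar T\cup\bar N$, where $\bar N$ is the Zariski closure of $N$. (4) Every irreducible component of $S(\omega)$ has codimension two in $P(4)$. -/

import Mathlib

/-! Binary quartics, their invariants, and the orbit foliation on the projective space of
binary quartics. -/

namespace BinaryQuartic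

open MvPolynomial

noncomputable section

/-! ### Binary forms -/

/-- The coordinate space `ℂ⁵` of `Sym⁴(ℂ²)`. -/
abbrev V5 : Type := Fin 5 → ℂ

/-- The binary quartic `∑ i, binom(4, i) a_i t₀^(4-i) t₁^i` with coordinates `a`. -/
def form (a : V5) : MvPolynomial (Fin 2) ℂ :=
  ∑ i : Fin 5, C ((Nat.choose 4 i : ℂ) * a i) * X 0 ^ (4 - (i : ℕ)) * X 1 ^ (i : ℕ)

/-- The exponent vector of the monomial `t₀^(4-i) t₁^i`. -/
def expo (i : Fin 5) : Fin 2 →₀ ℕ :=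
  Finsupp.single 0 (4 - (i : ℕ)) + Finsupp.single 1 (i : ℕ)

/-- The coordinates of a binary quartic; the inverse of `form`, see `form_coords` and
`coords_form`. -/
def coords (F : MvPolynomial (Fin 2) ℂ) : V5 :=
  fun i => coeff (expo i) F / (Nat.choose 4 i : ℂ)

theorem form_eq (a : V5) :
    form a = ∑ i : Fin 5, monomial (expo i) ((Nat.choose 4 i : ℂ) * a i) := by
  unfold form expo
  refine Finset.sum_congr rfl fun i _ => ?_
  rw [X_pow_eq_monomial, X_pow_eq_monomial, C_mul_monomial, monomial_mul]
  simp

theorem expo_injective : Function.Injective expo := by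
  intro i j h
  have := DFunLike.congr_fun h 1
  simp [expo] at this
  exact Fin.ext this

theorem choose_ne_zero (i : Fin 5) : (Nat.choose 4 i : ℂ) ≠ 0 := by
  have : Nat.choose 4 i ≠ 0 := (Nat.choose_pos (by omega)).ne'
  exact_mod_cast this

theorem coords_form (a : V5) : coords (form a) = a := by
  funext i
  rw [coords, form_eq, coeff_sum, Finset.sum_eq_single i]
  · rw [coeff_monomial, if_pos rfl]
    field_simp [choose_ne_zero i]
  · intro j _ hj
    rw [coeff_monomial, if_neg fun h => hj (expo_injective h)]
  · simp

theorem form_isHomogeneous (a : V5) : (form a).IsHomogeneous 4 := by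
  rw [form_eq]
  refine IsHomogeneous.sum _ _ _ fun i _ => isHomogeneous_monomial _ ?_
  simp [expo, Finsupp.degree_eq_sum, Fin.sum_univ_two]
  omega

theorem form_coords {F : MvPolynomial (Fin 2) ℂ} (hF : F.IsHomogeneous 4) :
    form (coords F) = F := by
  ext m
  rw [form_eq, coeff_sum]
  by_cases hm : m.degree = 4
  · have h2 : m 0 + m 1 = 4 := by
      simpa [Finsupp.degree_eq_sum, Fin.sum_univ_two] using hm
    have hme : m = expo ⟨m 1, by omega⟩ := by
      ext j
      fin_cases j
      · simp [expo]; omega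
      · simp [expo]
    rw [Finset.sum_eq_single (⟨m 1, by omega⟩ : Fin 5)]
    · rw [coeff_monomial, if_pos hme.symm, coords, ← hme]
      exact mul_div_cancel₀ _ (choose_ne_zero _)
    · intro j _ hj
      rw [coeff_monomial, if_neg]
      intro h
      exact hj (expo_injective (h.trans hme))
    · simp
  · rw [hF.coeff_eq_zero hm]
    have h1 := (form_isHomogeneous (coords F)).coeff_eq_zero hm
    rwa [form_eq, coeff_sum] at h1

/-- The linear form `v₀ t₀ + v₁ t₁`. -/
def linForm (v : Fin 2 → ℂ) : MvPolynomial (Fin 2) ℂ := ∑ i, C (v i) * X i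

/-- The substitution `t_j ↦ ∑ i, M i j t_i`, i.e. the map induced by the endomorphism `M` of
`V = ⟨t₀, t₁⟩` on the symmetric algebra of `V`. -/
def subst (M : Matrix (Fin 2) (Fin 2) ℂ) :
    MvPolynomial (Fin 2) ℂ →ₐ[ℂ] MvPolynomial (Fin 2) ℂ :=
  aeval fun j => linForm fun i => M i j

/-- The action of `M` on quartics, in coordinates. -/
def act (M : Matrix (Fin 2) (Fin 2) ℂ) (a : V5) : V5 := coords (subst M (form a))

theorem linForm_isHomogeneous (v : Fin 2 → ℂ) : (linForm v).IsHomogeneous 1 := by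
  refine IsHomogeneous.sum _ _ _ fun i _ => ?_
  simpa using (isHomogeneous_C (Fin 2) (v i)).mul (isHomogeneous_X ℂ i)

theorem form_act (M : Matrix (Fin 2) (Fin 2) ℂ) (a : V5) :
    form (act M a) = subst M (form a) := by
  refine form_coords ?_
  have h := (form_isHomogeneous a).aeval (fun j => linForm fun i => M i j)
    (n := 1) fun j => linForm_isHomogeneous _
  simpa [subst] using h

theorem subst_mul (M N : Matrix (Fin 2) (Fin 2) ℂ) (F : MvPolynomial (Fin 2) ℂ) :
    subst (M * N) F = subst M (subst N F) := by
  have : subst (M * N) = (subst M).comp (subst N) := by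
    refine algHom_ext fun j => ?_
    simp only [subst, linForm, aeval_X, AlgHom.comp_apply, Fin.sum_univ_two, Matrix.mul_apply,
      map_add, map_mul, algHom_C, algebraMap_eq]
    ring
  rw [this, AlgHom.comp_apply]

theorem act_mul (M N : Matrix (Fin 2) (Fin 2) ℂ) (a : V5) :
    act (M * N) a = act M (act N a) := by
  rw [act, subst_mul, ← form_act]
  rfl

theorem act_one (a : V5) : act 1 a = a := by
  have : subst 1 = AlgHom.id ℂ _ := by
    refine algHom_ext fun j => ?_
    fin_cases j <;> simp [subst, linForm, Matrix.one_apply]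
  rw [act, this, AlgHom.id_apply, coords_form]

theorem act_ne_zero (g : GL (Fin 2) ℂ) {a : V5} (ha : a ≠ 0) :
    act (g : Matrix (Fin 2) (Fin 2) ℂ) a ≠ 0 := by
  intro h
  apply ha
  have h1 : act ((g⁻¹ : GL (Fin 2) ℂ) : Matrix (Fin 2) (Fin 2) ℂ) (act (g : Matrix _ _ ℂ) a)
      = a := by
    rw [← act_mul, ← Units.val_mul, inv_mul_cancel, Units.val_one, act_one]
  rw [← h1, h]
  funext i
  simp [act, form, coords]

/-! ### The projective space of binary quartics -/

/-- The projective space `P(4) = ℙ(Sym⁴ ℂ²)`, in the coordinates `a`. -/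
def P4 : Type := Projectivization ℂ V5

/-- The point of `P4` represented by a nonzero vector. -/
def P4.mk (a : V5) (ha : a ≠ 0) : P4 := Projectivization.mk ℂ a ha

/-- A nonzero vector representing a point of `P4`. -/
def P4.rep (x : P4) : V5 := Projectivization.rep x

theorem P4.rep_ne_zero (x : P4) : x.rep ≠ 0 := Projectivization.rep_nonzero x

theorem P4.mk_rep (x : P4) : P4.mk x.rep x.rep_ne_zero = x := Projectivization.mk_rep x

/-- The Zariski topology on `P4`: the sets `f ≠ 0`, for `f` a homogeneous polynomial, form a
basis of open sets. -/
instance : TopologicalSpace P4 :=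
  TopologicalSpace.generateFrom
    {U | ∃ (n : ℕ) (f : MvPolynomial (Fin 5) ℂ), f.IsHomogeneous n ∧
      U = {x : P4 | eval x.rep f ≠ 0}}

/-- The orbit of a point of `P4` under `GL(2)`, equivalently under `PGL(2)`. -/
def orbit (x : P4) : Set P4 :=
  {y | ∃ g : GL (Fin 2) ℂ,
    y = P4.mk (act (g : Matrix (Fin 2) (Fin 2) ℂ) x.rep) (act_ne_zero g x.rep_ne_zero)}

/-- The Veronese map `v ↦ v⁴`. Its image in `P4` is the Veronese curve. -/
def veronese (v : Fin 2 → ℂ) : V5 := coords (linForm v ^ 4)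

/-- The embedded tangent line to the Veronese curve at `v⁴`, for `v ≠ 0`: the projectivization
of the image of the derivative at `v` of the Veronese map `ℂ² → ℂ⁵` (an image that contains
`v⁴` itself). -/
def tangentLine (v : Fin 2 → ℂ) : Set P4 :=
  {x | ∃ w : Fin 2 → ℂ, HasDerivAt (fun s : ℂ => veronese (v + s • w)) x.rep 0}

/-- The tangential surface of the Veronese curve: the union of its tangent lines. -/
def tangentialSurface : Set P4 := ⋃ (v : Fin 2 → ℂ) (_ : v ≠ 0), tangentLine v

/-- The set `N` of the quartics with two distinct double roots. -/
def twoDoubleRoots : Set P4 :=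
  {x | ∃ l m : Fin 2 → ℂ, LinearIndependent ℂ ![l, m] ∧
    form x.rep = linForm l ^ 2 * linForm m ^ 2}

/-! ### Polynomial one-forms on `ℂ⁵` and on `P4` -/

/-- A polynomial one-form `∑ i, η_i da_i` on `ℂ⁵`. -/
abbrev OneForm : Type := Fin 5 → MvPolynomial (Fin 5) ℂ

/-- The differential of a polynomial. -/
def diff (f : MvPolynomial (Fin 5) ℂ) : OneForm := fun i => pderiv i f

/-- The value `η_a(v)`. -/
def OneForm.apply (η : OneForm) (a v : V5) : ℂ := ∑ i, eval a (η i) * v i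

/-- `η` descends to a global section of `Ω¹(d + 2)` on `P4`: its coefficients are homogeneous of
degree `d + 1` and its contraction with the radial vector field vanishes. -/
def OneForm.IsProjective (η : OneForm) (d : ℕ) : Prop :=
  (∀ i, (η i).IsHomogeneous (d + 1)) ∧ ∑ i, η i * X i = 0

/-- The Frobenius condition `η ∧ dη = 0`: every coefficient of this three-form vanishes. -/
def OneForm.IsIntegrable (η : OneForm) : Prop :=
  ∀ i j k, η i * (pderiv j (η k) - pderiv k (η j)) + η j * (pderiv k (η i) - pderiv i (η k))
    + η k * (pderiv i (η j) - pderiv j (η i)) = 0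

/-- The zero set in `P4` of a one-form with homogeneous coefficients. -/
def OneForm.zeros (η : OneForm) : Set P4 := {x | ∀ i, eval x.rep (η i) = 0}

/-- The leaf through `x` of the foliation that an integrable projective one-form `η` defines
on the complement of its zeros: the points that can be joined to `x` by a `C¹` curve in this
complement that is tangent to `ker η`. Curves in `P4` are written through lifts to `ℂ⁵`. -/
def OneForm.leaf (η : OneForm) (x : P4) : Set P4 :=
  {y | ∃ γ : ℝ → V5, ContDiff ℝ 1 γ ∧
    (∃ h0 : γ 0 ≠ 0, P4.mk (γ 0) h0 = x) ∧ (∃ h1 : γ 1 ≠ 0, P4.mk (γ 1) h1 = y) ∧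
    ∀ t ∈ Set.Icc (0 : ℝ) 1,
      (∃ i, eval (γ t) (η i) ≠ 0) ∧ η.apply (γ t) (deriv γ t) = 0}

/-- The tangent space at `a` to the `GL(2)`-orbit of `a` in `ℂ⁵`, i.e. the image of the derivative
at `1` of the orbit map `M ↦ M · a`. This orbit contains the multiples of `a` by nonzero scalars,
and is the cone over the orbit of the point `[a]` of `P4`. -/
def orbitTangent (a : V5) : Set V5 :=
  {v | ∃ A : Matrix (Fin 2) (Fin 2) ℂ, HasDerivAt (fun s : ℂ => act (1 + s • A) a) v 0}

/-! ### The invariants -/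

/-- The quadratic invariant `a₀a₄ - 4a₁a₃ + 3a₂²`. -/
def invQ : MvPolynomial (Fin 5) ℂ := X 0 * X 4 - 4 * X 1 * X 3 + 3 * X 2 ^ 2

/-- The cubic invariant (catalecticant)
`a₀a₂a₄ - a₀a₃² + 2a₁a₂a₃ - a₁²a₄ - a₂³`. -/
def invC : MvPolynomial (Fin 5) ℂ :=
  X 0 * X 2 * X 4 - X 0 * X 3 ^ 2 + 2 * X 1 * X 2 * X 3 - X 1 ^ 2 * X 4 - X 2 ^ 3

/-- The one-form `ω = 2 Q dC - 3 C dQ`. -/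
def omega : OneForm := (2 * invQ) • diff invC - (3 * invC) • diff invQ

end

end BinaryQuartic

namespace BinaryQuartic

open MvPolynomial

/-! ### Explicit formulas for the action -/

/-! The polynomials Q and C are relative invariants of weights `det ^ 4` and `det ^ 6`, so Q³/C² is
an absolute invariant, and ω = QC · d log(C²/Q³). Hence ω kills the radial field, is integrable, and
is tangent to all orbits.

What remains rests on one normal form. A quartic with no simple root is the square of a product of
linear forms (`square_or_weierstrass`). Otherwise a simple root can be moved to infinity, which
gives 4t₀³t₁ + 4p t₀t₁³ + r t₁⁴, where Q = -4p and C = -r. There ω is explicit: it vanishes only for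
p = r = 0, and elsewhere its kernel is the image of the infinitesimal action. The torus scales (p,
r) with weights (2, 3), so [Q³ : C²] separates the orbits outside the zeros (`exists_act_eq_smul`).

Along a curve tangent to ker ω the ratio [Q³ : C²] is constant, by a Grönwall argument
(`cross_eq_of_proportional`), so leaves lie in orbits. Conversely a path of invertible matrices from
1 to g gives a curve in the leaf.

The zeros of ω are the quartics with Q = C = 0, which are those with a triple root, together with
the squares. Both families are irreducible by parametrization. Their codimension is at most two by
Krull's height theorem, and at least two because the discriminant hypersurface lies strictly between
them and the whole space. -/

theorem form_explicit (a : V5) : form a = C (a 0) * X 0 ^ 4 + C (4 * a 1) * X 0 ^ 3 * X 1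
    + C (6 * a 2) * X 0 ^ 2 * X 1 ^ 2 + C (4 * a 3) * X 0 * X 1 ^ 3 + C (a 4) * X 1 ^ 4 := by
  have h (n : ℕ) [n.AtLeastTwo] :
      (C (OfNat.ofNat n) : MvPolynomial (Fin 2) ℂ) = OfNat.ofNat n := map_ofNat C n
  simp [form, Fin.sum_univ_five, Nat.choose, h]

theorem form_add (a b : V5) : form (a + b) = form a + form b := by
  simp only [form_explicit, Pi.add_apply, mul_add, map_add]
  ring

theorem form_smul (c : ℂ) (a : V5) : form (c • a) = C c * form a := by
  simp only [form_explicit, Pi.smul_apply, smul_eq_mul, map_mul]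
  ring

theorem form_injective : Function.Injective form :=
  Function.LeftInverse.injective coords_form

theorem coords_add (F G : MvPolynomial (Fin 2) ℂ) : coords (F + G) = coords F + coords G := by
  funext i
  simp [coords, add_div]

theorem coords_C_mul (c : ℂ) (F : MvPolynomial (Fin 2) ℂ) : coords (C c * F) = c • coords F := by
  funext i
  simp [coords, mul_div_assoc]

theorem subst_C (M : Matrix (Fin 2) (Fin 2) ℂ) (c : ℂ) : subst M (C c) = C c := by
  simp [subst, algebraMap_eq]

theorem act_add (M : Matrix (Fin 2) (Fin 2) ℂ) (a b : V5) :
    act M (a + b) = act M a + act M b := by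
  rw [act, form_add, map_add, coords_add]
  rfl

theorem act_smul (M : Matrix (Fin 2) (Fin 2) ℂ) (c : ℂ) (a : V5) :
    act M (c • a) = c • act M a := by
  rw [act, form_smul, map_mul, subst_C, coords_C_mul]
  rfl

theorem linForm_eq (v : Fin 2 → ℂ) : linForm v = C (v 0) * X 0 + C (v 1) * X 1 := by
  simp [linForm, Fin.sum_univ_two]

theorem subst_X_zero (M : Matrix (Fin 2) (Fin 2) ℂ) :
    subst M (X 0) = C (M 0 0) * X 0 + C (M 1 0) * X 1 := by
  simp [subst, linForm_eq]

theorem subst_X_one (M : Matrix (Fin 2) (Fin 2) ℂ) :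
    subst M (X 1) = C (M 0 1) * X 0 + C (M 1 1) * X 1 := by
  simp [subst, linForm_eq]

theorem subst_linForm (M : Matrix (Fin 2) (Fin 2) ℂ) (v : Fin 2 → ℂ) :
    subst M (linForm v) = linForm (M.mulVec v) := by
  rw [linForm_eq, map_add, map_mul, map_mul, subst_C, subst_C, subst_X_zero, subst_X_one,
    linForm_eq]
  simp only [Matrix.mulVec, dotProduct, Fin.sum_univ_two, map_add, map_mul]
  ring

theorem act_apply (M : Matrix (Fin 2) (Fin 2) ℂ) (a : V5) : act M a =
    ![a 0 * M 0 0 ^ 4 + 4 * a 1 * M 0 0 ^ 3 * M 0 1 + 6 * a 2 * M 0 0 ^ 2 * M 0 1 ^ 2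
        + 4 * a 3 * M 0 0 * M 0 1 ^ 3 + a 4 * M 0 1 ^ 4,
      a 0 * M 0 0 ^ 3 * M 1 0 + a 1 * (3 * M 0 0 ^ 2 * M 1 0 * M 0 1 + M 0 0 ^ 3 * M 1 1)
        + 3 * a 2 * (M 0 0 * M 1 0 * M 0 1 ^ 2 + M 0 0 ^ 2 * M 0 1 * M 1 1)
        + a 3 * (M 1 0 * M 0 1 ^ 3 + 3 * M 0 0 * M 0 1 ^ 2 * M 1 1) + a 4 * M 0 1 ^ 3 * M 1 1,
      a 0 * M 0 0 ^ 2 * M 1 0 ^ 2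
        + 2 * a 1 * (M 0 0 * M 1 0 ^ 2 * M 0 1 + M 0 0 ^ 2 * M 1 0 * M 1 1)
        + a 2 * (M 1 0 ^ 2 * M 0 1 ^ 2 + 4 * M 0 0 * M 1 0 * M 0 1 * M 1 1
          + M 0 0 ^ 2 * M 1 1 ^ 2)
        + 2 * a 3 * (M 1 0 * M 0 1 ^ 2 * M 1 1 + M 0 0 * M 0 1 * M 1 1 ^ 2)
        + a 4 * M 0 1 ^ 2 * M 1 1 ^ 2,
      a 0 * M 0 0 * M 1 0 ^ 3 + a 1 * (M 1 0 ^ 3 * M 0 1 + 3 * M 0 0 * M 1 0 ^ 2 * M 1 1)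
        + 3 * a 2 * (M 1 0 ^ 2 * M 0 1 * M 1 1 + M 0 0 * M 1 0 * M 1 1 ^ 2)
        + a 3 * (3 * M 1 0 * M 0 1 * M 1 1 ^ 2 + M 0 0 * M 1 1 ^ 3) + a 4 * M 0 1 * M 1 1 ^ 3,
      a 0 * M 1 0 ^ 4 + 4 * a 1 * M 1 0 ^ 3 * M 1 1 + 6 * a 2 * M 1 0 ^ 2 * M 1 1 ^ 2
        + 4 * a 3 * M 1 0 * M 1 1 ^ 3 + a 4 * M 1 1 ^ 4] := by
  apply form_injective
  rw [form_act, form_explicit a, form_explicit]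
  simp only [map_add, map_mul, map_pow, subst_C, subst_X_zero, subst_X_one, Matrix.cons_val,
    map_ofNat]
  ring

/-! ### The invariants -/

theorem eval_invQ (a : V5) : eval a invQ = a 0 * a 4 - 4 * a 1 * a 3 + 3 * a 2 ^ 2 := by
  simp [invQ]

theorem eval_invC (a : V5) : eval a invC = a 0 * a 2 * a 4 - a 0 * a 3 ^ 2
    + 2 * a 1 * a 2 * a 3 - a 1 ^ 2 * a 4 - a 2 ^ 3 := by
  simp [invC]

theorem eval_invQ_act (M : Matrix (Fin 2) (Fin 2) ℂ) (a : V5) :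
    eval (act M a) invQ = M.det ^ 4 * eval a invQ := by
  rw [eval_invQ, eval_invQ, act_apply, Matrix.det_fin_two]
  simp only [Matrix.cons_val]
  ring

theorem eval_invC_act (M : Matrix (Fin 2) (Fin 2) ℂ) (a : V5) :
    eval (act M a) invC = M.det ^ 6 * eval a invC := by
  rw [eval_invC, eval_invC, act_apply, Matrix.det_fin_two]
  simp only [Matrix.cons_val]
  ring

theorem pderiv_ofNat {σ : Type*} (i : σ) (n : ℕ) [n.AtLeastTwo] :
    pderiv i (OfNat.ofNat n : MvPolynomial σ ℂ) = 0 :=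
  Derivation.map_natCast (pderiv i) n

theorem diff_invQ_apply (a v : V5) : (diff invQ).apply a v =
    a 4 * v 0 - 4 * a 3 * v 1 + 6 * a 2 * v 2 - 4 * a 1 * v 3 + a 0 * v 4 := by
  have h3 (i : Fin 5) : pderiv i (3 : MvPolynomial (Fin 5) ℂ) = 0 := pderiv_ofNat i 3
  have h4 (i : Fin 5) : pderiv i (4 : MvPolynomial (Fin 5) ℂ) = 0 := pderiv_ofNat i 4
  simp only [OneForm.apply, diff, invQ, Fin.sum_univ_five]
  simp [pderiv_X, h3, h4]
  ring

theorem diff_invC_apply (a v : V5) : (diff invC).apply a v =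
    (a 2 * a 4 - a 3 ^ 2) * v 0 + 2 * (a 2 * a 3 - a 1 * a 4) * v 1
      + (a 0 * a 4 + 2 * a 1 * a 3 - 3 * a 2 ^ 2) * v 2
      + 2 * (a 1 * a 2 - a 0 * a 3) * v 3 + (a 0 * a 2 - a 1 ^ 2) * v 4 := by
  have h2 (i : Fin 5) : pderiv i (2 : MvPolynomial (Fin 5) ℂ) = 0 := pderiv_ofNat i 2
  simp only [OneForm.apply, diff, invC, Fin.sum_univ_five]
  simp [pderiv_X, h2]
  ring

/-- The differential of a quadratic form is its polar form. Written through values of Q, it inherits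
equivariance from the additivity of the action, with no chain rule. -/
theorem diff_invQ_polarization (a v : V5) :
    (diff invQ).apply a v = eval (a + v) invQ - eval a invQ - eval v invQ := by
  simp only [diff_invQ_apply, eval_invQ, Pi.add_apply]
  ring

/-- The part of C(a + v) that is odd in v is dC_a(v) + C(v), because C is a cubic. -/
theorem diff_invC_polarization (a v : V5) : (diff invC).apply a v =
    (eval (a + v) invC - eval (a + (-1 : ℂ) • v) invC) / 2 - eval v invC := by
  simp only [diff_invC_apply, eval_invC, Pi.add_apply, Pi.smul_apply, smul_eq_mul]
  ring

theorem diff_invQ_act (M : Matrix (Fin 2) (Fin 2) ℂ) (a v : V5) :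
    (diff invQ).apply (act M a) (act M v) = M.det ^ 4 * (diff invQ).apply a v := by
  simp only [diff_invQ_polarization, ← act_add, eval_invQ_act]
  ring

theorem diff_invC_act (M : Matrix (Fin 2) (Fin 2) ℂ) (a v : V5) :
    (diff invC).apply (act M a) (act M v) = M.det ^ 6 * (diff invC).apply a v := by
  simp only [diff_invC_polarization, ← act_add, ← act_smul, eval_invC_act]
  ring

theorem omega_apply (a v : V5) : omega.apply a v =
    2 * eval a invQ * (diff invC).apply a v - 3 * eval a invC * (diff invQ).apply a v := by
  simp only [OneForm.apply, omega, Finset.mul_sum, ← Finset.sum_sub_distrib]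
  refine Finset.sum_congr rfl fun i _ => ?_
  simp
  ring

theorem omega_act (M : Matrix (Fin 2) (Fin 2) ℂ) (a v : V5) :
    omega.apply (act M a) (act M v) = M.det ^ 10 * omega.apply a v := by
  simp only [omega_apply, eval_invQ_act, eval_invC_act, diff_invQ_act, diff_invC_act]
  ring

/-! ### The one-form descends and is integrable -/

theorem isHomogeneous_ofNat (n : ℕ) [n.AtLeastTwo] :
    (OfNat.ofNat n : MvPolynomial (Fin 5) ℂ).IsHomogeneous 0 := by
  rw [← map_ofNat (C : ℂ →+* MvPolynomial (Fin 5) ℂ) n]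
  exact isHomogeneous_C _ _

theorem invQ_isHomogeneous : invQ.IsHomogeneous 2 := by
  have hX (i : Fin 5) : (X i : MvPolynomial (Fin 5) ℂ).IsHomogeneous 1 := isHomogeneous_X ℂ i
  have := (((hX 0).mul (hX 4)).sub (((isHomogeneous_ofNat 4).mul (hX 1)).mul (hX 3))).add
    ((isHomogeneous_ofNat 3).mul ((hX 2).pow 2))
  simpa [invQ] using this

theorem invC_isHomogeneous : invC.IsHomogeneous 3 := by
  have hX (i : Fin 5) : (X i : MvPolynomial (Fin 5) ℂ).IsHomogeneous 1 := isHomogeneous_X ℂ i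
  have := ((((((hX 0).mul (hX 2)).mul (hX 4)).sub ((hX 0).mul ((hX 3).pow 2))).add
    ((((isHomogeneous_ofNat 2).mul (hX 1)).mul (hX 2)).mul (hX 3))).sub
    (((hX 1).pow 2).mul (hX 4))).sub ((hX 2).pow 3)
  simpa [invC] using this

theorem omega_isHomogeneous (i : Fin 5) : (omega i).IsHomogeneous 4 := by
  have := (((isHomogeneous_ofNat 2).mul invQ_isHomogeneous).mul
    (invC_isHomogeneous.pderiv (i := i))).sub
    (((isHomogeneous_ofNat 3).mul invC_isHomogeneous).mul (invQ_isHomogeneous.pderiv (i := i)))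
  simpa [omega, diff] using this

/-- By Euler's identity the radial contraction is 2Q · 3C - 3C · 2Q. -/
theorem omega_isProjective : omega.IsProjective 3 := by
  refine ⟨omega_isHomogeneous, MvPolynomial.funext fun a => ?_⟩
  have h : eval a (∑ i, omega i * X i) = omega.apply a a := by simp [OneForm.apply]
  rw [h, omega_apply, diff_invQ_apply, diff_invC_apply, eval_invQ, eval_invC, map_zero]
  ring

theorem pderiv_pderiv_comm {σ : Type*} (i j : σ) (f : MvPolynomial σ ℂ) :
    pderiv i (pderiv j f) = pderiv j (pderiv i f) := by
  classical
  let D (k : σ) : Derivation ℂ (MvPolynomial σ ℂ) (MvPolynomial σ ℂ) := pderiv k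
  have h : ⁅D i, D j⁆ = 0 := by
    refine derivation_ext fun k => ?_
    simp [D, Derivation.commutator_apply, pderiv_X, Pi.single_apply, apply_ite (pderiv _)]
  have h' := DFunLike.congr_fun h f
  rwa [Derivation.commutator_apply, Derivation.zero_apply, sub_eq_zero] at h'

/-- The form η = c f dg - d g df has dη = (c + d) df ∧ dg, and η lies in the span of df and dg. -/
theorem isIntegrable_pencil (f g : MvPolynomial (Fin 5) ℂ) (c d : ℂ) :
    OneForm.IsIntegrable ((C c * f) • diff g - (C d * g) • diff f) := by
  intro i j k
  simp only [diff, Pi.sub_apply, Pi.smul_apply, smul_eq_mul, map_sub, Derivation.leibniz,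
    pderiv_C]
  rw [pderiv_pderiv_comm j i f, pderiv_pderiv_comm j i g, pderiv_pderiv_comm k i f,
    pderiv_pderiv_comm k i g, pderiv_pderiv_comm k j f, pderiv_pderiv_comm k j g]
  ring

theorem omega_isIntegrable : omega.IsIntegrable := by
  have h := isIntegrable_pencil invQ invC 2 3
  rwa [map_ofNat, map_ofNat] at h

/-! ### Points of the projective space and orbits -/

theorem P4.mk_eq_mk_iff {a b : V5} (ha : a ≠ 0) (hb : b ≠ 0) :
    P4.mk a ha = P4.mk b hb ↔ ∃ c : ℂ, c ≠ 0 ∧ a = c • b := by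
  refine (Projectivization.mk_eq_mk_iff' ℂ a b ha hb).trans
    ⟨fun ⟨c, hc⟩ => ⟨c, ?_, hc.symm⟩, fun ⟨c, _, hc⟩ => ⟨c, hc.symm⟩⟩
  rintro rfl
  exact ha (by rw [← hc, zero_smul])

theorem P4.exists_rep_mk {a : V5} (ha : a ≠ 0) :
    ∃ c : ℂ, c ≠ 0 ∧ (P4.mk a ha).rep = c • a := by
  rw [← P4.mk_eq_mk_iff (P4.rep_ne_zero _) ha, P4.mk_rep]

theorem mem_orbit_iff {x y : P4} : y ∈ orbit x ↔ ∃ (g : GL (Fin 2) ℂ) (c : ℂ), c ≠ 0 ∧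
    act (g : Matrix (Fin 2) (Fin 2) ℂ) x.rep = c • y.rep := by
  refine exists_congr fun g => ?_
  rw [eq_comm, ← P4.mk_eq_mk_iff (act_ne_zero g x.rep_ne_zero) y.rep_ne_zero, P4.mk_rep]

/-- Frees orbit membership from the representative chosen by `rep`. -/
theorem mk_mem_orbit_mk_iff {a b : V5} (ha : a ≠ 0) (hb : b ≠ 0) :
    P4.mk b hb ∈ orbit (P4.mk a ha) ↔ ∃ (g : GL (Fin 2) ℂ) (c : ℂ), c ≠ 0 ∧
      act (g : Matrix (Fin 2) (Fin 2) ℂ) a = c • b := by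
  obtain ⟨s, hs, hsa⟩ := P4.exists_rep_mk ha
  obtain ⟨t, ht, htb⟩ := P4.exists_rep_mk hb
  rw [mem_orbit_iff, hsa, htb]
  refine exists_congr fun g => ⟨fun ⟨c, hc, h⟩ => ⟨s⁻¹ * (c * t), by positivity, ?_⟩,
    fun ⟨c, hc, h⟩ => ⟨s * (c * t⁻¹), by positivity, ?_⟩⟩
  · rw [act_smul] at h
    rw [mul_smul, mul_smul, ← h, inv_smul_smul₀ hs]
  · rw [act_smul, h, smul_smul, smul_smul, mul_assoc, mul_assoc, inv_mul_cancel₀ ht, mul_one]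

/-! ### The normal form of a quartic with a simple root -/

/-- The coordinates of the quartic `4 t₀³ t₁ + 4 p t₀ t₁³ + r t₁⁴`. -/
def weierstrass (p r : ℂ) : V5 := ![0, 1, 0, p, r]

theorem exists_act_eq_weierstrass {a : V5} (h0 : a 0 = 0) (h1 : a 1 ≠ 0) :
    ∃ (g : GL (Fin 2) ℂ) (p r : ℂ), act (g : Matrix (Fin 2) (Fin 2) ℂ) a = weierstrass p r := by
  -- A lower triangular matrix preserves the factor t₁. The entry 1/a₁ normalizes the coefficient of
  -- t₀³t₁, and the lower left entry removes t₀²t₁².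
  let M : Matrix (Fin 2) (Fin 2) ℂ := !![1, 0; -a 2 / (2 * a 1) / a 1, 1 / a 1]
  have hM : M.det ≠ 0 := by simp [M, Matrix.det_fin_two, h1]
  refine ⟨Matrix.GeneralLinearGroup.mkOfDetNeZero M hM, act M a 3, act M a 4, ?_⟩
  change act M a = _
  have e : act M a = ![act M a 0, act M a 1, act M a 2, act M a 3, act M a 4] := by
    ext i; fin_cases i <;> rfl
  rw [e, weierstrass]
  congr! 1
  · simp [act_apply, M, h0]
  · congr! 1
    · simp [act_apply, M, h0, h1]
    · congr! 1
      simp [act_apply, M, h0]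
      field_simp
      ring

theorem exists_simple_root_quadratic {a b c : ℂ} (h : b ^ 2 - 4 * a * c ≠ 0)
    (hab : a ≠ 0 ∨ b ≠ 0) :
    ∃ z : ℂ, a * z ^ 2 + b * z + c = 0 ∧ 2 * a * z + b ≠ 0 := by
  by_cases ha : a = 0
  · subst ha
    have hb : b ≠ 0 := by simpa using hab
    exact ⟨-c / b, by field_simp; ring, by simpa using hb⟩
  · obtain ⟨s, hs⟩ := IsAlgClosed.exists_pow_nat_eq (b ^ 2 - 4 * a * c) (n := 2) (by norm_num)
    refine ⟨(s - b) / (2 * a), ?_, ?_⟩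
    · field_simp
      linear_combination hs
    · have : 2 * a * ((s - b) / (2 * a)) + b = s := by field_simp; ring
      rw [this]
      rintro rfl
      exact h (by rw [← hs]; ring)

theorem exists_root_at_infinity (a : V5) : ∃ g : GL (Fin 2) ℂ,
    act (g : Matrix (Fin 2) (Fin 2) ℂ) a 0 = 0 := by
  by_cases h : a 0 = 0
  · exact ⟨1, by rw [Units.val_one, act_one, h]⟩
  · let P : Polynomial ℂ := .C (a 0) * .X ^ 4 + .C (4 * a 1) * .X ^ 3 + .C (6 * a 2) * .X ^ 2
      + .C (4 * a 3) * .X + .C (a 4)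
    have hP : P.degree = 4 := by
      simp only [P]
      compute_degree!
    obtain ⟨z, hz⟩ := IsAlgClosed.exists_root P (by rw [hP]; norm_num)
    -- The leading coefficient of the transformed quartic is the value of the form at the first row
    -- (z, 1).
    let M : Matrix (Fin 2) (Fin 2) ℂ := !![z, 1; 1, 0]
    have hM : M.det ≠ 0 := by simp [M, Matrix.det_fin_two]
    refine ⟨Matrix.GeneralLinearGroup.mkOfDetNeZero M hM, ?_⟩
    change act M a 0 = 0
    simp [P] at hz
    simp [act_apply, M]
    linear_combination hz

/-- If t₁ is not a simple factor, the quartic is t₁² q with q = 6a₂t₀² + 4a₃t₀t₁ + a₄t₁². If disc q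
= 0, then q is the square of a linear form. Otherwise q has a simple root at a finite point, hence
away from the double root t₁ = 0, and this root can be moved to infinity. -/
theorem exists_square_or_simple_root {a : V5} (h0 : a 0 = 0) :
    (∃ l m : Fin 2 → ℂ, form a = linForm l ^ 2 * linForm m ^ 2) ∨
    ∃ g : GL (Fin 2) ℂ, act (g : Matrix (Fin 2) (Fin 2) ℂ) a 0 = 0 ∧
      act (g : Matrix (Fin 2) (Fin 2) ℂ) a 1 ≠ 0 := by
  by_cases h1 : a 1 = 0
  · by_cases hd : (4 * a 3) ^ 2 - 4 * (6 * a 2) * a 4 = 0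
    · left
      obtain ⟨m, hm⟩ : ∃ m : Fin 2 → ℂ,
          6 * a 2 = m 0 ^ 2 ∧ 2 * a 3 = m 0 * m 1 ∧ a 4 = m 1 ^ 2 := by
        by_cases h2 : a 2 = 0
        · have h3 : a 3 = 0 := by simpa [h2] using hd
          obtain ⟨s, hs⟩ := IsAlgClosed.exists_pow_nat_eq (a 4) (n := 2) (by norm_num)
          exact ⟨![0, s], by simp [h2], by simp [h3], by simp [hs]⟩
        · obtain ⟨s, hs⟩ := IsAlgClosed.exists_pow_nat_eq (6 * a 2) (n := 2) (by norm_num)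
          have hs0 : s ≠ 0 := by
            rintro rfl
            exact h2 (by simpa using hs.symm)
          refine ⟨![s, 2 * a 3 / s], by simp [hs], by simp; field_simp, ?_⟩
          simp
          field_simp
          linear_combination a 4 * hs - hd / 4
      obtain ⟨h2, h3, h4⟩ := hm
      have e2 := congrArg (C (σ := Fin 2)) h2
      have e3 := congrArg (C (σ := Fin 2)) h3
      have e4 := congrArg (C (σ := Fin 2)) h4
      refine ⟨![0, 1], m, ?_⟩
      rw [form_explicit, h0, h1, linForm_eq, linForm_eq]
      simp only [map_mul, map_pow, map_ofNat, Matrix.cons_val, map_zero, map_one, mul_zero]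
        at e2 e3 e4 ⊢
      linear_combination X 0 ^ 2 * X 1 ^ 2 * e2 + 2 * X 0 * X 1 ^ 3 * e3 + X 1 ^ 4 * e4
    · right
      obtain ⟨z, hz, hz'⟩ := exists_simple_root_quadratic hd (by
        by_contra! h
        simp [h] at hd)
      -- Four times the new a₁ is the derivative of q(z, 1) at the root, nonzero because the root is
      -- simple.
      let M : Matrix (Fin 2) (Fin 2) ℂ := !![z, 1; 1, 0]
      have hM : M.det ≠ 0 := by simp [M, Matrix.det_fin_two]
      refine ⟨Matrix.GeneralLinearGroup.mkOfDetNeZero M hM, ?_⟩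
      change act M a 0 = 0 ∧ act M a 1 ≠ 0
      simp [act_apply, M, h0, h1]
      refine ⟨by linear_combination hz, fun h => hz' ?_⟩
      linear_combination 4 * h
  · exact Or.inr ⟨1, by simpa [act_one] using ⟨h0, h1⟩⟩

/-- A quartic without simple roots is the square of a product of two linear forms. -/
theorem square_or_weierstrass (a : V5) :
    (∃ l m : Fin 2 → ℂ, form a = linForm l ^ 2 * linForm m ^ 2) ∨
    ∃ (g : GL (Fin 2) ℂ) (p r : ℂ),
      act (g : Matrix (Fin 2) (Fin 2) ℂ) a = weierstrass p r := by
  obtain ⟨g, hg⟩ := exists_root_at_infinity a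
  rcases exists_square_or_simple_root hg with ⟨l, m, h⟩ | ⟨g', h0, h1⟩
  · left
    let N : Matrix (Fin 2) (Fin 2) ℂ := (g⁻¹ : GL (Fin 2) ℂ)
    have e : form a = subst N (form (act g a)) := by
      rw [← form_act, ← act_mul, ← Units.val_mul, inv_mul_cancel, Units.val_one, act_one]
    refine ⟨N.mulVec l, N.mulVec m, ?_⟩
    rw [e, h, map_mul, map_pow, map_pow, subst_linForm, subst_linForm]
  · right
    obtain ⟨g'', p, r, h⟩ := exists_act_eq_weierstrass h0 h1
    refine ⟨g'' * (g' * g), p, r, ?_⟩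
    rw [Units.val_mul, act_mul, Units.val_mul, act_mul, h]

theorem eval_invQ_weierstrass (p r : ℂ) : eval (weierstrass p r) invQ = -4 * p := by
  simp [eval_invQ, weierstrass]

theorem eval_invC_weierstrass (p r : ℂ) : eval (weierstrass p r) invC = -r := by
  simp [eval_invC, weierstrass]

/-- The coefficients 8p and -12r show that ω vanishes at a normal form only if p = r = 0. -/
theorem omega_weierstrass (p r : ℂ) (v : V5) : omega.apply (weierstrass p r) v =
    (8 * p ^ 3 + 3 * r ^ 2) * v 0 + 4 * p * r * v 1 - 16 * p ^ 2 * v 2 - 12 * r * v 3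
      + 8 * p * v 4 := by
  rw [omega_apply, eval_invQ_weierstrass, eval_invC_weierstrass, diff_invC_apply, diff_invQ_apply]
  simp [weierstrass]
  ring

theorem det_ne_zero (g : GL (Fin 2) ℂ) : (g : Matrix (Fin 2) (Fin 2) ℂ).det ≠ 0 :=
  (Matrix.isUnits_det_units g).ne_zero

theorem act_inv_act (g : GL (Fin 2) ℂ) (a : V5) :
    act ((g⁻¹ : GL (Fin 2) ℂ) : Matrix (Fin 2) (Fin 2) ℂ)
      (act (g : Matrix (Fin 2) (Fin 2) ℂ) a) = a := by
  rw [← act_mul, ← Units.val_mul, inv_mul_cancel, Units.val_one, act_one]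

theorem act_act_inv (g : GL (Fin 2) ℂ) (a : V5) :
    act (g : Matrix (Fin 2) (Fin 2) ℂ)
      (act ((g⁻¹ : GL (Fin 2) ℂ) : Matrix (Fin 2) (Fin 2) ℂ) a) = a := by
  rw [← act_mul, ← Units.val_mul, mul_inv_cancel, Units.val_one, act_one]

theorem exists_eval_omega_ne_zero_iff {a : V5} :
    (∃ i, eval a (omega i) ≠ 0) ↔ ∃ v, omega.apply a v ≠ 0 := by
  constructor
  · rintro ⟨i, hi⟩
    refine ⟨Pi.single i 1, ?_⟩
    simpa [OneForm.apply, Pi.single_apply] using hi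
  · rintro ⟨v, hv⟩
    by_contra! h
    exact hv (by simp [OneForm.apply, h])

theorem exists_eval_omega_act_ne_zero {a : V5} {M : Matrix (Fin 2) (Fin 2) ℂ} (hM : M.det ≠ 0)
    (h : ∃ i, eval a (omega i) ≠ 0) : ∃ i, eval (act M a) (omega i) ≠ 0 := by
  rw [exists_eval_omega_ne_zero_iff] at h ⊢
  obtain ⟨v, hv⟩ := h
  exact ⟨act M v, by rw [omega_act]; exact mul_ne_zero (pow_ne_zero _ hM) hv⟩

theorem invariants_ne_zero {a : V5} (h : ∃ i, eval a (omega i) ≠ 0) :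
    ¬ (eval a invQ = 0 ∧ eval a invC = 0) := by
  rw [exists_eval_omega_ne_zero_iff] at h
  obtain ⟨v, hv⟩ := h
  rintro ⟨hQ, hC⟩
  exact hv (by rw [omega_apply, hQ, hC]; ring)

/-! ### The tangent spaces of the orbits -/

/-- The infinitesimal action of a matrix on quartics, in coordinates. -/
def infAct (A : Matrix (Fin 2) (Fin 2) ℂ) (a : V5) : V5 :=
  ![4 * a 0 * A 0 0 + 4 * a 1 * A 0 1,
    a 0 * A 1 0 + a 1 * (3 * A 0 0 + A 1 1) + 3 * a 2 * A 0 1,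
    2 * a 1 * A 1 0 + 2 * a 2 * (A 0 0 + A 1 1) + 2 * a 3 * A 0 1,
    3 * a 2 * A 1 0 + a 3 * (A 0 0 + 3 * A 1 1) + a 4 * A 0 1,
    4 * a 3 * A 1 0 + 4 * a 4 * A 1 1]

theorem hasDerivAt_act (A : Matrix (Fin 2) (Fin 2) ℂ) (a : V5) :
    HasDerivAt (fun s : ℂ => act (1 + s • A) a) (infAct A a) 0 := by
  have hd (i j : Fin 2) : HasDerivAt
      (fun s : ℂ => (1 + s • A) i j) (A i j) 0 := by
    have := ((hasDerivAt_id (0 : ℂ)).mul_const (A i j)).const_add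
      ((1 : Matrix (Fin 2) (Fin 2) ℂ) i j)
    simpa using this
  have e (i j : Fin 2) : (1 + (0 : ℂ) • A) i j = (1 : Matrix (Fin 2) (Fin 2) ℂ) i j := by simp
  have h00 := hd 0 0
  have h01 := hd 0 1
  have h10 := hd 1 0
  have h11 := hd 1 1
  refine hasDerivAt_pi.2 fun i => ?_
  simp only [act_apply]
  fin_cases i
  · refine ((((((h00.pow 4).const_mul (a 0)).fun_add
      (((h00.pow 3).const_mul (4 * a 1)).fun_mul h01)).fun_add
      (((h00.pow 2).const_mul (6 * a 2)).fun_mul (h01.pow 2))).fun_add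
      ((h00.const_mul (4 * a 3)).fun_mul (h01.pow 3))).fun_add
      ((h01.pow 4).const_mul (a 4))).congr_deriv ?_
    simp only [e]
    simp [infAct]
    ring
  · refine (((((((h00.pow 3).const_mul (a 0)).fun_mul h10).fun_add
      ((((((h00.pow 2).const_mul 3).fun_mul h10).fun_mul h01).fun_add
        ((h00.pow 3).fun_mul h11)).const_mul (a 1))).fun_add
      ((((h00.fun_mul h10).fun_mul (h01.pow 2)).fun_add
        (((h00.pow 2).fun_mul h01).fun_mul h11)).const_mul (3 * a 2))).fun_add
      (((h10.fun_mul (h01.pow 3)).fun_add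
        (((h00.const_mul 3).fun_mul (h01.pow 2)).fun_mul h11)).const_mul (a 3))).fun_add
      (((h01.pow 3).const_mul (a 4)).fun_mul h11)).congr_deriv ?_
    simp only [e]
    simp [infAct]
  · refine (((((((h00.pow 2).const_mul (a 0)).fun_mul (h10.pow 2)).fun_add
      ((((h00.fun_mul (h10.pow 2)).fun_mul h01).fun_add
        (((h00.pow 2).fun_mul h10).fun_mul h11)).const_mul (2 * a 1))).fun_add
      (((((h10.pow 2).fun_mul (h01.pow 2)).fun_add
        ((((h00.const_mul 4).fun_mul h10).fun_mul h01).fun_mul h11)).fun_add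
        ((h00.pow 2).fun_mul (h11.pow 2))).const_mul (a 2))).fun_add
      ((((h10.fun_mul (h01.pow 2)).fun_mul h11).fun_add
        ((h00.fun_mul h01).fun_mul (h11.pow 2))).const_mul (2 * a 3))).fun_add
      (((h01.pow 2).const_mul (a 4)).fun_mul (h11.pow 2))).congr_deriv ?_
    simp only [e]
    simp [infAct]
    ring
  · refine (((((h00.const_mul (a 0)).fun_mul (h10.pow 3)).fun_add
      ((((h10.pow 3).fun_mul h01).fun_add
        (((h00.const_mul 3).fun_mul (h10.pow 2)).fun_mul h11)).const_mul (a 1))).fun_add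
      (((((h10.pow 2).fun_mul h01).fun_mul h11).fun_add
        ((h00.fun_mul h10).fun_mul (h11.pow 2))).const_mul (3 * a 2))).fun_add
      (((((h10.const_mul 3).fun_mul h01).fun_mul (h11.pow 2)).fun_add
        (h00.fun_mul (h11.pow 3))).const_mul (a 3)) |>.fun_add
      ((h01.const_mul (a 4)).fun_mul (h11.pow 3))).congr_deriv ?_
    simp only [e]
    simp [infAct]
  · refine ((((((h10.pow 4).const_mul (a 0)).fun_add
      (((h10.pow 3).const_mul (4 * a 1)).fun_mul h11)).fun_add
      (((h10.pow 2).const_mul (6 * a 2)).fun_mul (h11.pow 2))).fun_add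
      ((h10.const_mul (4 * a 3)).fun_mul (h11.pow 3))).fun_add
      ((h11.pow 4).const_mul (a 4))).congr_deriv ?_
    simp only [e]
    simp [infAct]
    ring

theorem mem_orbitTangent_iff {a v : V5} : v ∈ orbitTangent a ↔ ∃ A, infAct A a = v :=
  exists_congr fun A => ⟨fun h => (hasDerivAt_act A a).unique h, fun h => h ▸ hasDerivAt_act A a⟩

/-- Along A the invariants change by 4 tr(A) Q and 6 tr(A) C, and these two contributions cancel in
ω. -/
theorem omega_infAct (A : Matrix (Fin 2) (Fin 2) ℂ) (a : V5) :
    omega.apply a (infAct A a) = 0 := by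
  rw [omega_apply, diff_invQ_apply, diff_invC_apply, eval_invQ, eval_invC]
  simp only [infAct, Matrix.cons_val]
  ring

/-- Differentiate g(1 + sA)a = (1 + s gAg⁻¹)(ga) at s = 0. -/
theorem act_infAct (g : GL (Fin 2) ℂ) (A : Matrix (Fin 2) (Fin 2) ℂ) (a : V5) :
    act (g : Matrix (Fin 2) (Fin 2) ℂ) (infAct A a) =
      infAct ((g : Matrix (Fin 2) (Fin 2) ℂ) * A * ((g⁻¹ : GL (Fin 2) ℂ) : Matrix _ _ ℂ))
        (act (g : Matrix (Fin 2) (Fin 2) ℂ) a) := by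
  set G : Matrix (Fin 2) (Fin 2) ℂ := (g : Matrix (Fin 2) (Fin 2) ℂ)
  set H : Matrix (Fin 2) (Fin 2) ℂ := ((g⁻¹ : GL (Fin 2) ℂ) : Matrix (Fin 2) (Fin 2) ℂ)
  have hGH : H * G = 1 := by
    rw [← Units.val_mul, inv_mul_cancel, Units.val_one]
  let L : V5 →ₗ[ℂ] V5 := ⟨⟨act G, act_add G⟩, act_smul G⟩
  have h1 : HasDerivAt (fun s : ℂ => act G (act (1 + s • A) a)) (act G (infAct A a)) 0 :=
    (LinearMap.toContinuousLinearMap L).hasFDerivAt.comp_hasDerivAt 0 (hasDerivAt_act A a)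
  have h2 := hasDerivAt_act (G * A * H) (act G a)
  refine h1.unique (h2.congr_of_eventuallyEq (.of_forall fun s => ?_))
  simp only [← act_mul]
  congr 1
  rw [add_mul, one_mul, smul_mul_assoc, mul_assoc (G * A), hGH, mul_one, mul_add, mul_one,
    mul_smul_comm]

/-- Five linear equations in the four entries of A, whose one compatibility relation is ω(v) = 0. If
p ≠ 0, the first four determine A and ω gives the last. If p = 0, the relation is the fourth
equation, v₃ = r v₀/4. -/
theorem exists_infAct_weierstrass {p r : ℂ} (h : ¬ (p = 0 ∧ r = 0)) {v : V5}
    (hv : omega.apply (weierstrass p r) v = 0) : ∃ A, infAct A (weierstrass p r) = v := by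
  rw [omega_weierstrass] at hv
  by_cases hp : p = 0
  · have hr : r ≠ 0 := fun hr => h ⟨hp, hr⟩
    subst hp
    have hv' : v 3 = r * v 0 / 4 := by
      have : r * (r * v 0 - 4 * v 3) = 0 := by linear_combination hv / 3
      rcases mul_eq_zero.1 this with h | h
      · exact absurd h hr
      · linear_combination -h / 4
    refine ⟨!![(v 1 - v 4 / (4 * r)) / 3, v 0 / 4; v 2 / 2, v 4 / (4 * r)], ?_⟩
    ext i
    fin_cases i <;> (simp [infAct, weierstrass, hv']; field_simp) <;> ring
  · let x := v 0 / 4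
    let y := (v 2 - 2 * p * x) / 2
    let u := (3 * ((v 3 - r * x) / p) - v 1) / 8
    let w := (v 1 - u) / 3
    refine ⟨!![w, x; y, u], ?_⟩
    ext i
    fin_cases i <;> simp [infAct, weierstrass, w, u, y, x] <;> field_simp
    · ring
    · ring
    · ring
    · linear_combination (-2) * hv

/-! ### Quartics l² m² and l³ m, and the kernel of ω at a general point. -/

/-- The coordinates of the quartic `l² m²`. -/
noncomputable def squareProd (l m : Fin 2 → ℂ) : V5 :=
  ![l 0 ^ 2 * m 0 ^ 2, (l 0 * l 1 * m 0 ^ 2 + l 0 ^ 2 * m 0 * m 1) / 2,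
    (l 0 ^ 2 * m 1 ^ 2 + 4 * l 0 * l 1 * m 0 * m 1 + l 1 ^ 2 * m 0 ^ 2) / 6,
    (l 0 * l 1 * m 1 ^ 2 + l 1 ^ 2 * m 0 * m 1) / 2, l 1 ^ 2 * m 1 ^ 2]

/-- The coordinates of the quartic `l³ m`. -/
noncomputable def cubeProd (l m : Fin 2 → ℂ) : V5 :=
  ![l 0 ^ 3 * m 0, (3 * l 0 ^ 2 * l 1 * m 0 + l 0 ^ 3 * m 1) / 4,
    (l 0 * l 1 ^ 2 * m 0 + l 0 ^ 2 * l 1 * m 1) / 2,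
    (l 1 ^ 3 * m 0 + 3 * l 0 * l 1 ^ 2 * m 1) / 4, l 1 ^ 3 * m 1]

theorem form_squareProd (l m : Fin 2 → ℂ) :
    form (squareProd l m) = linForm l ^ 2 * linForm m ^ 2 := by
  have e1 : 4 * squareProd l m 1 = 2 * (l 0 * l 1 * m 0 ^ 2 + l 0 ^ 2 * m 0 * m 1) := by
    simp only [squareProd, Matrix.cons_val]; ring
  have e2 : 6 * squareProd l m 2 =
      l 0 ^ 2 * m 1 ^ 2 + 4 * l 0 * l 1 * m 0 * m 1 + l 1 ^ 2 * m 0 ^ 2 := by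
    simp only [squareProd, Matrix.cons_val]; ring
  have e3 : 4 * squareProd l m 3 = 2 * (l 0 * l 1 * m 1 ^ 2 + l 1 ^ 2 * m 0 * m 1) := by
    simp only [squareProd, Matrix.cons_val]; ring
  rw [form_explicit, linForm_eq, linForm_eq, e1, e2, e3]
  simp only [squareProd, Matrix.cons_val, map_add, map_mul, map_pow, map_ofNat]
  ring

theorem form_cubeProd (l m : Fin 2 → ℂ) :
    form (cubeProd l m) = linForm l ^ 3 * linForm m := by
  have e1 : 4 * cubeProd l m 1 = 3 * l 0 ^ 2 * l 1 * m 0 + l 0 ^ 3 * m 1 := by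
    simp only [cubeProd, Matrix.cons_val]; ring
  have e2 : 6 * cubeProd l m 2 = 3 * (l 0 * l 1 ^ 2 * m 0 + l 0 ^ 2 * l 1 * m 1) := by
    simp only [cubeProd, Matrix.cons_val]; ring
  have e3 : 4 * cubeProd l m 3 = l 1 ^ 3 * m 0 + 3 * l 0 * l 1 ^ 2 * m 1 := by
    simp only [cubeProd, Matrix.cons_val]; ring
  rw [form_explicit, linForm_eq, linForm_eq, e1, e2, e3]
  simp only [cubeProd, Matrix.cons_val, map_add, map_mul, map_pow, map_ofNat]
  ring

theorem act_squareProd (M : Matrix (Fin 2) (Fin 2) ℂ) (l m : Fin 2 → ℂ) :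
    act M (squareProd l m) = squareProd (M.mulVec l) (M.mulVec m) := by
  apply form_injective
  rw [form_act, form_squareProd, form_squareProd, map_mul, map_pow, map_pow, subst_linForm,
    subst_linForm]

theorem act_cubeProd (M : Matrix (Fin 2) (Fin 2) ℂ) (l m : Fin 2 → ℂ) :
    act M (cubeProd l m) = cubeProd (M.mulVec l) (M.mulVec m) := by
  apply form_injective
  rw [form_act, form_cubeProd, form_cubeProd, map_mul, map_pow, subst_linForm, subst_linForm]

/-- Let D = Q³ - 27C². On D = 0 one has Q dD = -27 C ω. For independent l and m both C ≠ 0 and dD =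
0, since two branches of the discriminant cross there. For dependent l and m, Q = C = 0. -/
theorem omega_squareProd (l m : Fin 2 → ℂ) (v : V5) : omega.apply (squareProd l m) v = 0 := by
  rw [omega_apply, diff_invQ_apply, diff_invC_apply, eval_invQ, eval_invC]
  simp only [squareProd, Matrix.cons_val]
  ring

theorem eval_invQ_cubeProd (l m : Fin 2 → ℂ) : eval (cubeProd l m) invQ = 0 := by
  rw [eval_invQ]
  simp only [cubeProd, Matrix.cons_val]
  ring

theorem eval_invC_cubeProd (l m : Fin 2 → ℂ) : eval (cubeProd l m) invC = 0 := by
  rw [eval_invC]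
  simp only [cubeProd, Matrix.cons_val]
  ring

theorem omega_cubeProd (l m : Fin 2 → ℂ) (v : V5) : omega.apply (cubeProd l m) v = 0 := by
  rw [omega_apply, eval_invQ_cubeProd, eval_invC_cubeProd]
  ring

theorem exists_weierstrass_of_omega_ne_zero {a : V5} (h : ∃ i, eval a (omega i) ≠ 0) :
    ∃ (g : GL (Fin 2) ℂ) (p r : ℂ),
      act (g : Matrix (Fin 2) (Fin 2) ℂ) a = weierstrass p r ∧ ¬ (p = 0 ∧ r = 0) := by
  rcases square_or_weierstrass a with ⟨l, m, e⟩ | ⟨g, p, r, e⟩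
  · rw [← form_squareProd] at e
    obtain ⟨v, hv⟩ := exists_eval_omega_ne_zero_iff.1 h
    rw [form_injective e] at hv
    exact absurd (omega_squareProd l m v) hv
  · refine ⟨g, p, r, e, ?_⟩
    rintro ⟨rfl, rfl⟩
    refine invariants_ne_zero (exists_eval_omega_act_ne_zero (det_ne_zero g) h) ?_
    rw [e, eval_invQ_weierstrass, eval_invC_weierstrass]
    simp

/-- Both sides are equivariant, so a kernel vector is moved to the normal form, written there as an
infinitesimal action, and moved back. -/
theorem ker_omega_eq_orbitTangent {a : V5} (h : ∃ i, eval a (omega i) ≠ 0) :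
    {v : V5 | omega.apply a v = 0} = orbitTangent a := by
  ext v
  rw [mem_orbitTangent_iff]
  refine ⟨fun (hv : omega.apply a v = 0) => ?_, fun ⟨A, hA⟩ => hA ▸ omega_infAct A a⟩
  obtain ⟨g, p, r, e, hpr⟩ := exists_weierstrass_of_omega_ne_zero h
  have hgv := omega_act (g : Matrix (Fin 2) (Fin 2) ℂ) a v
  rw [hv, mul_zero, e] at hgv
  obtain ⟨A, hA⟩ := exists_infAct_weierstrass hpr hgv
  have := act_infAct g⁻¹ A (weierstrass p r)
  rw [hA, ← e, act_inv_act, act_inv_act] at this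
  exact ⟨_, this.symm⟩

/-! ### The leaves are the orbits -/

theorem hasDerivAt_eval (f : MvPolynomial (Fin 5) ℂ) {γ : ℝ → V5} {γ' : V5} {t : ℝ}
    (h : HasDerivAt γ γ' t) :
    HasDerivAt (fun s => eval (γ s) f) ((diff f).apply (γ t) γ') t := by
  induction f using MvPolynomial.induction_on with
  | C c => simpa [diff, OneForm.apply] using hasDerivAt_const t c
  | add p q hp hq =>
    simpa [diff, OneForm.apply, add_mul, Finset.sum_add_distrib] using hp.fun_add hq
  | mul_X p i hp =>
    have := hp.fun_mul (hasDerivAt_pi.1 h i)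
    simp only [map_mul, eval_X]
    refine this.congr_deriv ?_
    simp only [diff, OneForm.apply, pderiv_mul, map_add, map_mul, eval_X, add_mul,
      Finset.sum_add_distrib, Finset.sum_mul]
    congr 1
    · exact Finset.sum_congr rfl fun j _ => by ring
    · rw [Finset.sum_eq_single i]
      · simp
      · intro j _ hj
        simp [pderiv_X_of_ne hj.symm]
      · simp

theorem continuous_diff_apply (f : MvPolynomial (Fin 5) ℂ) {γ v : ℝ → V5} (hγ : Continuous γ)
    (hv : Continuous v) : Continuous fun t => (diff f).apply (γ t) (v t) := by
  unfold OneForm.apply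
  refine continuous_finsetSum _ fun i _ => ?_
  exact ((MvPolynomial.continuous_eval _).comp hγ).mul ((continuous_apply i).comp hv)

/-- Two functions with proportional derivatives `(q', c') = L (2 q, 3 c)` satisfy
`[q³ : c²] = const`. -/
theorem cross_eq_of_proportional {q c q' c' : ℝ → ℂ}
    (hq : ∀ t ∈ Set.Icc (0 : ℝ) 1, HasDerivAt q (q' t) t)
    (hc : ∀ t ∈ Set.Icc (0 : ℝ) 1, HasDerivAt c (c' t) t)
    (hq' : ContinuousOn q' (Set.Icc 0 1)) (hc' : ContinuousOn c' (Set.Icc 0 1))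
    (h0 : ∀ t ∈ Set.Icc (0 : ℝ) 1, ¬ (q t = 0 ∧ c t = 0))
    (h : ∀ t ∈ Set.Icc (0 : ℝ) 1, 2 * q t * c' t - 3 * c t * q' t = 0) :
    q 0 ^ 3 * c 1 ^ 2 = c 0 ^ 2 * q 1 ^ 3 := by
  have hqc : ContinuousOn q (Set.Icc 0 1) := fun t ht => (hq t ht).continuousAt.continuousWithinAt
  have hcc : ContinuousOn c (Set.Icc 0 1) := fun t ht => (hc t ht).continuousAt.continuousWithinAt
  -- The vector (q', c') is a multiple of (2q, 3c). Hermitian projection gives the factor `L` with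
  -- denominator `N` = |2q|² + |3c|², which never vanishes, so `L` is continuous even where q or c
  -- is zero.
  let N : ℝ → ℂ := fun t => 4 * (q t * star (q t)) + 9 * (c t * star (c t))
  let L : ℝ → ℂ := fun t => (2 * star (q t) * q' t + 3 * star (c t) * c' t) / N t
  have hN (t : ℝ) (ht : t ∈ Set.Icc (0 : ℝ) 1) : N t ≠ 0 := by
    have e : N t = ((4 * Complex.normSq (q t) + 9 * Complex.normSq (c t) : ℝ) : ℂ) := by
      simp [N, Complex.mul_conj]
    rw [e]
    norm_cast
    have h1 := Complex.normSq_nonneg (q t)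
    have h2 := Complex.normSq_nonneg (c t)
    intro h3
    exact h0 t ht ⟨Complex.normSq_eq_zero.1 (by linarith), Complex.normSq_eq_zero.1 (by linarith)⟩
  have hLc : ContinuousOn L (Set.Icc 0 1) := by
    refine ContinuousOn.div ?_ ?_ hN <;> fun_prop
  obtain ⟨K, hK⟩ := isCompact_Icc.exists_bound_of_continuousOn hLc
  have hLq (t : ℝ) (ht : t ∈ Set.Icc (0 : ℝ) 1) : q' t = L t * (2 * q t) := by
    have := hN t ht
    simp only [L]
    field_simp
    simp only [N]
    linear_combination (-3 * star (c t)) * h t ht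
  have hLc' (t : ℝ) (ht : t ∈ Set.Icc (0 : ℝ) 1) : c' t = L t * (3 * c t) := by
    have := hN t ht
    simp only [L]
    field_simp
    simp only [N]
    linear_combination (2 * star (q t)) * h t ht
  -- Both c² and q³ satisfy y' = 6Ly, hence so does `f`. As f(0) = 0 and `L` is bounded, Grönwall
  -- gives f = 0.
  let f : ℝ → ℂ := fun t => q 0 ^ 3 * c t ^ 2 - c 0 ^ 2 * q t ^ 3
  have hf (t : ℝ) (ht : t ∈ Set.Icc (0 : ℝ) 1) : HasDerivAt f (6 * L t * f t) t := by
    refine ((((hc t ht).fun_pow 2).const_mul (q 0 ^ 3)).fun_sub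
      (((hq t ht).fun_pow 3).const_mul (c 0 ^ 2))).congr_deriv ?_
    rw [hLq t ht, hLc' t ht]
    simp only [f]
    push_cast
    ring
  have := eq_zero_of_abs_deriv_le_mul_abs_self_of_eq_zero_right (f := f) (K := 6 * K)
    (a := 0) (b := 1) (fun t ht => (hf t ht).continuousAt.continuousWithinAt)
    (fun t ht => (hf t (Set.Ico_subset_Icc_self ht)).hasDerivWithinAt) (by simp only [f]; ring)
    (fun t ht => by
      rw [norm_mul, norm_mul, Complex.norm_ofNat]
      gcongr
      exact hK t (Set.Ico_subset_Icc_self ht)) 1 (by simp)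
  exact sub_eq_zero.1 this

/-- Weighted homogeneous coordinates `(p, r)` of weights `2` and `3` are determined up to scaling by
`[p³ : r²]`. -/
theorem exists_scaling {p r p' r' : ℂ} (h : ¬ (p = 0 ∧ r = 0)) (h' : ¬ (p' = 0 ∧ r' = 0))
    (e : p ^ 3 * r' ^ 2 = r ^ 2 * p' ^ 3) :
    ∃ s : ℂ, s ≠ 0 ∧ p' = s ^ 2 * p ∧ r' = s ^ 3 * r := by
  by_cases hp : p = 0
  · subst hp
    have hr : r ≠ 0 := fun hr => h ⟨rfl, hr⟩
    have hp' : p' = 0 := by simpa [hr] using e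
    subst hp'
    have hr' : r' ≠ 0 := fun hr => h' ⟨rfl, hr⟩
    obtain ⟨s, hs⟩ := IsAlgClosed.exists_pow_nat_eq (r' / r) (n := 3) (by norm_num)
    refine ⟨s, ?_, by simp, by rw [hs]; field_simp⟩
    rintro rfl
    rw [zero_pow (by norm_num), eq_comm, div_eq_zero_iff] at hs
    tauto
  · by_cases hr : r = 0
    · subst hr
      have hr' : r' = 0 := by simpa [hp] using e
      subst hr'
      have hp' : p' ≠ 0 := fun hr => h' ⟨hr, rfl⟩
      obtain ⟨s, hs⟩ := IsAlgClosed.exists_pow_nat_eq (p' / p) (n := 2) (by norm_num)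
      refine ⟨s, ?_, by rw [hs]; field_simp, by simp⟩
      rintro rfl
      rw [zero_pow (by norm_num), eq_comm, div_eq_zero_iff] at hs
      tauto
    · have hp' : p' ≠ 0 := by
        rintro rfl
        exact h' ⟨rfl, by simpa [hp] using e⟩
      have hr' : r' ≠ 0 := by
        rintro rfl
        exact hp' (by simpa [hr] using e.symm)
      -- The witness is s³/s² = (r'/r)/(p'/p).
      refine ⟨r' * p / (r * p'), by simp [hp, hr, hp', hr'], ?_, ?_⟩
      · field_simp
        linear_combination -e
      · field_simp
        linear_combination -e

theorem exists_act_eq_smul {a b : V5} (ha : ∃ i, eval a (omega i) ≠ 0)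
    (hb : ∃ i, eval b (omega i) ≠ 0)
    (e : eval a invQ ^ 3 * eval b invC ^ 2 = eval a invC ^ 2 * eval b invQ ^ 3) :
    ∃ (g : GL (Fin 2) ℂ) (c : ℂ), c ≠ 0 ∧ act (g : Matrix (Fin 2) (Fin 2) ℂ) a = c • b := by
  obtain ⟨g, p, r, hg, hpr⟩ := exists_weierstrass_of_omega_ne_zero ha
  obtain ⟨g', p', r', hg', hpr'⟩ := exists_weierstrass_of_omega_ne_zero hb
  have e1 : p ^ 3 * r' ^ 2 = r ^ 2 * p' ^ 3 := by
    have h1 := eval_invQ_act g a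
    have h2 := eval_invC_act g a
    have h3 := eval_invQ_act g' b
    have h4 := eval_invC_act g' b
    rw [hg, eval_invQ_weierstrass] at h1
    rw [hg, eval_invC_weierstrass] at h2
    rw [hg', eval_invQ_weierstrass] at h3
    rw [hg', eval_invC_weierstrass] at h4
    have : (-4 * p) ^ 3 * (-r') ^ 2 = (-r) ^ 2 * (-4 * p') ^ 3 := by
      rw [h1, h2, h3, h4]
      linear_combination (g : Matrix (Fin 2) (Fin 2) ℂ).det ^ 12 *
        (g' : Matrix (Fin 2) (Fin 2) ℂ).det ^ 12 * e
    linear_combination -this / 64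
  obtain ⟨s, hs, h2, h3⟩ := exists_scaling hpr hpr' e1
  -- Scaling t₁ by s sends (1, p, r) to (s, s³p, s⁴r) = s · (1, s²p, s³r).
  let M : Matrix (Fin 2) (Fin 2) ℂ := !![1, 0; 0, s]
  have hM : M.det ≠ 0 := by simp [M, Matrix.det_fin_two, hs]
  let D := Matrix.GeneralLinearGroup.mkOfDetNeZero M hM
  have hD : act (D : Matrix (Fin 2) (Fin 2) ℂ) (weierstrass p r) = s • weierstrass p' r' := by
    change act M _ = _
    rw [act_apply, h2, h3]
    ext i
    fin_cases i <;> simp [weierstrass, M]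
    · ring
    · ring
  refine ⟨g'⁻¹ * (D * g), s, hs, ?_⟩
  rw [Units.val_mul, act_mul, Units.val_mul, act_mul, hg, hD, act_smul, ← hg', act_inv_act]

theorem leaf_subset_orbit (x : P4) : omega.leaf x ⊆ orbit x := by
  rintro y ⟨γ, hγ, ⟨h0, rfl⟩, ⟨h1, rfl⟩, h⟩
  rw [mk_mem_orbit_mk_iff]
  refine exists_act_eq_smul (h 0 (by simp)).1 (h 1 (by simp)).1 ?_
  have hd (t : ℝ) : HasDerivAt γ (deriv γ t) t :=
    ((hγ.differentiable (by norm_num)) t).hasDerivAt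
  have hc : Continuous (deriv γ) := hγ.continuous_deriv (by norm_num)
  refine cross_eq_of_proportional (q := fun t => eval (γ t) invQ) (c := fun t => eval (γ t) invC)
    (fun t _ => hasDerivAt_eval invQ (hd t)) (fun t _ => hasDerivAt_eval invC (hd t))
    (continuous_diff_apply invQ hγ.continuous hc).continuousOn
    (continuous_diff_apply invC hγ.continuous hc).continuousOn
    (fun t ht => invariants_ne_zero (h t ht).1) (fun t ht => ?_)
  rw [← omega_apply]
  exact (h t ht).2

/-- Two points are joined in the plane by a parabolic arc that avoids finitely many points. -/
theorem exists_arc_avoiding (S : Set ℂ) (hS : S.Finite) (h0 : (0 : ℂ) ∉ S) (h1 : (1 : ℂ) ∉ S) :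
    ∃ c : ℝ, ∀ t ∈ Set.Icc (0 : ℝ) 1, (t : ℂ) + c * t * (1 - t) * Complex.I ∉ S := by
  -- An interior point z lies on the arc for only one c, namely Im z / (Re z (1 - Re z)), so
  -- finitely many values of c are bad.
  obtain ⟨c, hc⟩ := (hS.image fun z : ℂ => z.im / (z.re * (1 - z.re))).exists_notMem
  refine ⟨c, fun t ht hz => ?_⟩
  rcases eq_or_ne t 0 with rfl | ht0
  · exact h0 (by simpa using hz)
  rcases eq_or_ne t 1 with rfl | ht1
  · exact h1 (by simpa using hz)
  refine hc ⟨_, hz, ?_⟩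
  have e : (t : ℂ) + c * t * (1 - t) * Complex.I = ⟨t, c * t * (1 - t)⟩ := by
    apply Complex.ext <;> simp
  rw [e]
  have : 1 - t ≠ 0 := sub_ne_zero.2 ht1.symm
  field_simp

theorem finite_det_zero {A : Matrix (Fin 2) (Fin 2) ℂ} :
    {z : ℂ | (1 + z • A).det = 0}.Finite := by
  let P : Polynomial ℂ := (1 + .X * .C (A 0 0)) * (1 + .X * .C (A 1 1))
    - (.X * .C (A 0 1)) * (.X * .C (A 1 0))
  have hP : P ≠ 0 := by
    intro h
    have := congrArg (Polynomial.eval 0) h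
    simp [P] at this
  refine (Polynomial.finite_setOfPred_isRoot hP).subset fun z hz => ?_
  have e : (1 + z • A).det = P.eval z := by
    simp [P, Matrix.det_fin_two]
    ring
  exact e.symm.trans hz

theorem contDiff_act {M : ℝ → Matrix (Fin 2) (Fin 2) ℂ}
    (hM : ∀ i j, ContDiff ℝ 1 fun t => M t i j) (a : V5) :
    ContDiff ℝ 1 fun t => act (M t) a := by
  have hM00 := hM 0 0
  have hM01 := hM 0 1
  have hM10 := hM 1 0
  have hM11 := hM 1 1
  refine contDiff_pi.2 fun i => ?_
  simp only [act_apply]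
  fin_cases i <;> simp <;> fun_prop

/-- The curve (1 + p(t)(g - 1))x, with p an arc from 0 to 1 avoiding the zeros of the determinant D,
stays in the orbit. Along it Q and C are D⁴ and D⁶ times constants, so the terms of ω(γ') cancel. -/
theorem orbit_subset_leaf {x : P4} (hx : x ∉ omega.zeros) : orbit x ⊆ omega.leaf x := by
  rintro y ⟨g, rfl⟩
  have hx' : ∃ i, eval x.rep (omega i) ≠ 0 := by simpa [OneForm.zeros] using hx
  let A : Matrix (Fin 2) (Fin 2) ℂ := g - 1
  have hA : 1 + (1 : ℂ) • A = g := by simp [A]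
  obtain ⟨c, hc⟩ := exists_arc_avoiding _ (finite_det_zero (A := A)) (by simp)
    (by
      change ¬ (1 + (1 : ℂ) • A).det = 0
      rw [hA]
      exact det_ne_zero g)
  let p : ℝ → ℂ := fun t => t + c * t * (1 - t) * Complex.I
  have hp : ContDiff ℝ 1 p := by
    have h : ContDiff ℝ 1 (fun t : ℝ => (t : ℂ)) := Complex.ofRealCLM.contDiff
    unfold p
    fun_prop
  have hM (i j : Fin 2) : ContDiff ℝ 1 fun t => (1 + p t • A) i j := by
    simp only [Matrix.add_apply, Matrix.smul_apply, smul_eq_mul]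
    fun_prop
  let γ : ℝ → V5 := fun t => act (1 + p t • A) x.rep
  have hγ : ContDiff ℝ 1 γ := contDiff_act hM x.rep
  have hdet : ContDiff ℝ 1 fun t => (1 + p t • A).det := by
    simp only [Matrix.det_fin_two]
    exact ((hM 0 0).mul (hM 1 1)).sub ((hM 0 1).mul (hM 1 0))
  have e0 : γ 0 = x.rep := by simp [γ, p, act_one]
  have e1 : γ 1 = act g x.rep := by
    simp only [γ, p]
    simp [A]
  refine ⟨γ, hγ, ?_, ?_, fun t ht => ⟨exists_eval_omega_act_ne_zero (hc t ht) hx', ?_⟩⟩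
  · rw [e0]
    exact ⟨x.rep_ne_zero, x.mk_rep⟩
  · refine ⟨e1 ▸ act_ne_zero g x.rep_ne_zero, ?_⟩
    congr 1
  · have hd : HasDerivAt γ (deriv γ t) t := ((hγ.differentiable (by norm_num)) t).hasDerivAt
    have hD := ((hdet.differentiable (by norm_num)) t).hasDerivAt
    have hQ := (hasDerivAt_eval invQ hd).unique (f := fun t => eval (γ t) invQ) (by
      simp only [γ, eval_invQ_act]
      exact (hD.fun_pow 4).mul_const _)
    have hC := (hasDerivAt_eval invC hd).unique (f := fun t => eval (γ t) invC) (by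
      simp only [γ, eval_invC_act]
      exact (hD.fun_pow 6).mul_const _)
    rw [omega_apply, hQ, hC]
    simp only [γ, eval_invQ_act, eval_invC_act]
    push_cast
    ring

/-! ### The Zariski topology of the projective space -/

theorem eval_smul_of_isHomogeneous {f : MvPolynomial (Fin 5) ℂ} {n : ℕ} (hf : f.IsHomogeneous n)
    (c : ℂ) (a : V5) : eval (c • a) f = c ^ n * eval a f := by
  rw [eval_eq', eval_eq', Finset.mul_sum]
  refine Finset.sum_congr rfl fun d hd => ?_
  have hn : ∑ i, d i = n := by
    have := hf (mem_support_iff.1 hd)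
    simpa [Finsupp.weight_apply, Finsupp.sum_fintype] using this
  simp only [Pi.smul_apply, smul_eq_mul, mul_pow, Finset.prod_mul_distrib,
    Finset.prod_pow_eq_pow_sum, hn]
  ring

theorem eval_rep_mk_eq_zero_iff {f : MvPolynomial (Fin 5) ℂ} {n : ℕ} (hf : f.IsHomogeneous n)
    {a : V5} (ha : a ≠ 0) : eval (P4.mk a ha).rep f = 0 ↔ eval a f = 0 := by
  obtain ⟨c, hc, e⟩ := P4.exists_rep_mk ha
  simp [e, eval_smul_of_isHomogeneous hf, hc]

theorem isTopologicalBasis_basicOpens : TopologicalSpace.IsTopologicalBasis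
    {U | ∃ (n : ℕ) (f : MvPolynomial (Fin 5) ℂ), f.IsHomogeneous n ∧
      U = {x : P4 | eval x.rep f ≠ 0}} where
  exists_subset_inter := by
    rintro _ ⟨n, f, hf, rfl⟩ _ ⟨m, g, hg, rfl⟩ x hx
    refine ⟨_, ⟨_, f * g, hf.mul hg, rfl⟩, ?_, fun y hy => ?_⟩
    · change eval x.rep (f * g) ≠ 0
      rw [map_mul]
      exact mul_ne_zero hx.1 hx.2
    · change eval y.rep (f * g) ≠ 0 at hy
      rw [map_mul] at hy
      exact ⟨left_ne_zero_of_mul hy, right_ne_zero_of_mul hy⟩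
  sUnion_eq := by
    refine Set.sUnion_eq_univ_iff.2 fun x => ⟨_, ⟨0, 1, isHomogeneous_one _ _, rfl⟩, ?_⟩
    change eval x.rep 1 ≠ 0
    simp
  eq_generateFrom := rfl

theorem isOpen_basicOpen {f : MvPolynomial (Fin 5) ℂ} {n : ℕ} (hf : f.IsHomogeneous n) :
    IsOpen {x : P4 | eval x.rep f ≠ 0} :=
  isTopologicalBasis_basicOpens.isOpen ⟨n, f, hf, rfl⟩

theorem isClosed_zeros {f : MvPolynomial (Fin 5) ℂ} {n : ℕ} (hf : f.IsHomogeneous n) :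
    IsClosed {x : P4 | eval x.rep f = 0} := by
  rw [← isOpen_compl_iff]
  exact isOpen_basicOpen hf

theorem isClosed_omega_zeros : IsClosed omega.zeros := by
  have : omega.zeros = ⋂ i, {x : P4 | eval x.rep (omega i) = 0} := by
    ext x
    simp [OneForm.zeros]
  rw [this]
  exact isClosed_iInter fun i => isClosed_zeros (omega_isHomogeneous i)

/-- A set parametrized by polynomials is irreducible. -/
theorem isIrreducible_of_parametrization {σ : Type*} {S : Set P4} (hS : S.Nonempty)
    (φ : Fin 5 → MvPolynomial σ ℂ)
    (h1 : ∀ x ∈ S, ∃ p : σ → ℂ, x.rep = fun i => eval p (φ i))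
    (h2 : ∀ (p : σ → ℂ) (h : (fun i => eval p (φ i)) ≠ 0), P4.mk _ h ∈ S) :
    IsIrreducible S := by
  refine ⟨hS, ?_⟩
  rintro U V hU hV ⟨x, hxS, hxU⟩ ⟨y, hyS, hyV⟩
  obtain ⟨_, ⟨n, f, hf, rfl⟩, hxf, hfU⟩ := isTopologicalBasis_basicOpens.exists_subset_of_mem_open
    hxU hU
  obtain ⟨_, ⟨m, g, hg, rfl⟩, hyg, hgV⟩ := isTopologicalBasis_basicOpens.exists_subset_of_mem_open
    hyV hV
  have he (p : σ → ℂ) (f : MvPolynomial (Fin 5) ℂ) :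
      eval p (bind₁ φ f) = eval (fun i => eval p (φ i)) f := by
    exact eval₂Hom_bind₁ (RingHom.id ℂ) p φ f
  obtain ⟨p, hp⟩ := h1 x hxS
  obtain ⟨q, hq⟩ := h1 y hyS
  obtain ⟨i, hi⟩ : ∃ i, φ i ≠ 0 := by
    by_contra! h
    exact x.rep_ne_zero (by rw [hp]; funext i; simp [h])
  have hF : bind₁ φ f ≠ 0 := fun h => hxf (by rw [hp, ← he, h, map_zero])
  have hG : bind₁ φ g ≠ 0 := fun h => hyg (by rw [hq, ← he, h, map_zero])
  -- A product of nonzero polynomials is nonzero at some parameter. The factor `φ i` ensures that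
  -- this parameter gives a point of projective space.
  obtain ⟨r, hr⟩ : ∃ r, eval r (bind₁ φ f * bind₁ φ g * φ i) ≠ 0 := by
    by_contra! h
    exact mul_ne_zero (mul_ne_zero hF hG) hi (MvPolynomial.funext fun r => by rw [h, map_zero])
  rw [map_mul, map_mul, he, he] at hr
  have hr0 : (fun i => eval r (φ i)) ≠ 0 := fun h => right_ne_zero_of_mul hr (congrFun h i)
  refine ⟨P4.mk _ hr0, h2 r hr0, hfU ?_, hgV ?_⟩
  · exact fun h => left_ne_zero_of_mul (left_ne_zero_of_mul hr)
      ((eval_rep_mk_eq_zero_iff hf hr0).1 h)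
  · exact fun h => right_ne_zero_of_mul (left_ne_zero_of_mul hr)
      ((eval_rep_mk_eq_zero_iff hg hr0).1 h)

/-! ### Homogeneous vanishing ideals -/

/-- The affine cone, without its vertex, over a set of points of the projective space. -/
def cone (S : Set P4) : Set V5 := {a | ∃ h : a ≠ 0, P4.mk a h ∈ S}

theorem smul_mem_cone {S : Set P4} {a : V5} (ha : a ∈ cone S) {c : ℂ} (hc : c ≠ 0) :
    c • a ∈ cone S := by
  obtain ⟨h, hS⟩ := ha
  refine ⟨smul_ne_zero hc h, ?_⟩
  rwa [(P4.mk_eq_mk_iff (smul_ne_zero hc h) h).2 ⟨c, hc, rfl⟩]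

theorem rep_mem_cone {S : Set P4} {x : P4} (hx : x ∈ S) : x.rep ∈ cone S :=
  ⟨x.rep_ne_zero, by rwa [P4.mk_rep]⟩

theorem mem_vanishingIdeal_cone_iff {S : Set P4} {f : MvPolynomial (Fin 5) ℂ} :
    f ∈ vanishingIdeal ℂ (cone S) ↔ ∀ a ∈ cone S, eval a f = 0 := by
  simp [mem_vanishingIdeal_iff, aeval_eq_eval]

theorem mem_vanishingIdeal_cone_iff_of_isHomogeneous {S : Set P4} {f : MvPolynomial (Fin 5) ℂ}
    {n : ℕ} (hf : f.IsHomogeneous n) :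
    f ∈ vanishingIdeal ℂ (cone S) ↔ S ⊆ {x | eval x.rep f = 0} := by
  rw [mem_vanishingIdeal_cone_iff]
  refine ⟨fun h x hx => h _ (rep_mem_cone hx), fun h a ⟨ha, haS⟩ => ?_⟩
  exact (eval_rep_mk_eq_zero_iff hf ha).1 (h haS)

attribute [local instance] MvPolynomial.gradedAlgebra

/-- A cone is stable under scaling, so f(ca) = Σ cʲ fⱼ(a) vanishes for every c ≠ 0, and each fⱼ(a)
is zero. -/
theorem vanishingIdeal_cone_isHomogeneous (S : Set P4) :
    (vanishingIdeal ℂ (cone S)).IsHomogeneous (homogeneousSubmodule (Fin 5) ℂ) := by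
  intro k f hf
  change (decomposition.decompose' f k : MvPolynomial (Fin 5) ℂ) ∈ _
  rw [decomposition.decompose'_apply]
  rw [mem_vanishingIdeal_cone_iff] at hf ⊢
  intro a ha
  let P : Polynomial ℂ := ∑ j ∈ Finset.range (f.totalDegree + 1),
    .C (eval a (homogeneousComponent j f)) * .X ^ j
  have hP : P = 0 := by
    refine Polynomial.eq_of_infinite_eval_eq _ _
      ((Set.finite_singleton (0 : ℂ)).infinite_compl.mono fun c hc => ?_)
    have h := hf _ (smul_mem_cone ha hc)
    rw [← sum_homogeneousComponent f, map_sum] at h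
    change P.eval c = Polynomial.eval c 0
    rw [Polynomial.eval_zero, ← h, Polynomial.eval_finsetSum]
    refine Finset.sum_congr rfl fun j _ => ?_
    rw [eval_smul_of_isHomogeneous (homogeneousComponent_isHomogeneous j f)]
    rw [Polynomial.eval_mul, Polynomial.eval_C, Polynomial.eval_pow, Polynomial.eval_X, mul_comm]
  by_cases hk : k ∈ Finset.range (f.totalDegree + 1)
  · have := congrArg (fun p => Polynomial.coeff p k) hP
    simpa [P, Polynomial.finsetSum_coeff, Polynomial.coeff_X_pow, hk] using this
  · rw [homogeneousComponent_eq_zero _ _ (by simpa using hk), map_zero]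

/-- For a homogeneous ideal, primality may be tested on homogeneous elements, where it says that two
basic open sets meeting `S` meet inside `S`. -/
theorem vanishingIdeal_cone_isPrime {S : Set P4} (hS : IsIrreducible S) :
    (vanishingIdeal ℂ (cone S)).IsPrime := by
  refine (vanishingIdeal_cone_isHomogeneous S).isPrime_of_homogeneous_mem_or_mem ?_ ?_
  · obtain ⟨x, hx⟩ := hS.nonempty
    intro h
    have h1 : (1 : MvPolynomial (Fin 5) ℂ) ∈ vanishingIdeal ℂ (cone S) := by
      rw [h]
      trivial
    rw [mem_vanishingIdeal_cone_iff] at h1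
    simpa using h1 _ (rep_mem_cone hx)
  · rintro f g ⟨n, hf⟩ ⟨m, hg⟩ hfg
    rw [mem_homogeneousSubmodule] at hf hg
    rw [mem_vanishingIdeal_cone_iff_of_isHomogeneous hf,
      mem_vanishingIdeal_cone_iff_of_isHomogeneous hg]
    rw [mem_vanishingIdeal_cone_iff_of_isHomogeneous (hf.mul hg)] at hfg
    by_contra! h
    obtain ⟨x, hxS, hx⟩ := Set.not_subset.1 h.1
    obtain ⟨y, hyS, hy⟩ := Set.not_subset.1 h.2
    obtain ⟨z, hzS, hz1, hz2⟩ := hS.2 _ _ (isOpen_basicOpen hf) (isOpen_basicOpen hg)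
      ⟨x, hxS, hx⟩ ⟨y, hyS, hy⟩
    have : eval z.rep (f * g) = 0 := hfg hzS
    rw [map_mul] at this
    exact mul_ne_zero hz1 hz2 this

theorem vanishingIdeal_cone_lt {Z W : Set P4} (hZ : IsClosed Z) (h : Z ⊂ W) :
    vanishingIdeal ℂ (cone W) < vanishingIdeal ℂ (cone Z) := by
  refine lt_of_le_not_ge (vanishingIdeal_anti_mono fun a ⟨ha, haS⟩ => ⟨ha, h.1 haS⟩) fun hle => ?_
  obtain ⟨x, hxW, hxZ⟩ := Set.not_subset.1 h.2
  obtain ⟨_, ⟨n, f, hf, rfl⟩, hxf, hfZ⟩ := isTopologicalBasis_basicOpens.exists_subset_of_mem_open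
    (show x ∈ Zᶜ from hxZ) hZ.isOpen_compl
  have h1 : f ∈ vanishingIdeal ℂ (cone Z) := by
    rw [mem_vanishingIdeal_cone_iff_of_isHomogeneous hf]
    intro y hy
    by_contra h
    exact hfZ h hy
  have h2 := hle h1
  rw [mem_vanishingIdeal_cone_iff_of_isHomogeneous hf] at h2
  exact hxf (h2 hxW)

/-- Vanishing ideals reverse strict inclusions, so a chain of irreducible closed sets above `Z`
becomes a chain of primes below the ideal of its cone. -/
theorem coheight_le_height (Z : TopologicalSpace.IrreducibleCloseds P4) :
    Order.coheight Z ≤ (vanishingIdeal ℂ (cone (Z : Set P4))).height := by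
  let F : (TopologicalSpace.IrreducibleCloseds P4)ᵒᵈ → PrimeSpectrum (MvPolynomial (Fin 5) ℂ) :=
    fun W => ⟨_, vanishingIdeal_cone_isPrime (OrderDual.ofDual W).isIrreducible⟩
  have hF : StrictMono F := fun W W' h =>
    vanishingIdeal_cone_lt (OrderDual.ofDual W').isClosed (SetLike.coe_ssubset_coe.2 h)
  have := Order.height_le_height_apply_of_strictMono F hF (OrderDual.toDual Z)
  rw [← PrimeSpectrum.height_eq_orderHeight] at this
  exact this

/-- A closed set that is defined by two equations outside of a hypersurface has codimension at
most two. -/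
theorem coheight_le_two (Z : TopologicalSpace.IrreducibleCloseds P4)
    {f g u : MvPolynomial (Fin 5) ℂ} (hf : f ∈ vanishingIdeal ℂ (cone (Z : Set P4)))
    (hg : g ∈ vanishingIdeal ℂ (cone (Z : Set P4)))
    (hu : u ∉ vanishingIdeal ℂ (cone (Z : Set P4)))
    (h : ∀ a, eval a f = 0 → eval a g = 0 → eval a u ≠ 0 → a ∈ cone (Z : Set P4)) :
    Order.coheight Z ≤ 2 := by
  refine (coheight_le_height Z).trans ?_
  have hp := vanishingIdeal_cone_isPrime Z.isIrreducible
  -- For a prime P between (f, g) and the ideal of Z, and k in the latter, u k vanishes on the zero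
  -- locus of P. The Nullstellensatz puts u k in P, and u is not in P. Krull's height theorem then
  -- applies.
  have hmin : vanishingIdeal ℂ (cone (Z : Set P4)) ∈ (Ideal.span {f, g}).minimalPrimes := by
    refine ⟨⟨hp, ?_⟩, fun P hP hPZ k hk => ?_⟩
    · rw [Ideal.span_le]
      rintro k (rfl | rfl)
      exacts [hf, hg]
    · have hP1 := hP.1
      have hfP : f ∈ P := hP.2 (Ideal.subset_span (by simp))
      have hgP : g ∈ P := hP.2 (Ideal.subset_span (by simp))
      have huk : u * k ∈ P := by
        rw [← IsPrime.vanishingIdeal_zeroLocus (K := ℂ) P]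
        intro a ha
        rw [aeval_eq_eval, map_mul]
        by_cases h0 : eval a u = 0
        · rw [h0, zero_mul]
        · have h1 := ha f hfP
          have h2 := ha g hgP
          rw [aeval_eq_eval] at h1 h2
          rw [mem_vanishingIdeal_cone_iff.1 hk a (h a h1 h2 h0), mul_zero]
      exact (hP1.mem_or_mem huk).resolve_left fun h => hu (hPZ h)
  refine (Ideal.height_le_card_of_mem_minimalPrimes_span (Set.toFinite _) hmin).trans ?_
  have h2 := Set.ncard_insert_le f {g}
  rw [Set.ncard_singleton] at h2
  exact_mod_cast h2

/-! ### The tangential surface and the quartics with two double roots -/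

theorem linearIndependent_pair_iff {l m : Fin 2 → ℂ} :
    LinearIndependent ℂ ![l, m] ↔ l 0 * m 1 - l 1 * m 0 ≠ 0 := by
  rw [LinearIndependent.pair_iff]
  constructor
  · intro h hd
    obtain ⟨h1, h2⟩ := h (m 0) (-l 0) (by
      ext i
      fin_cases i <;> simp
      · ring
      · linear_combination -hd)
    obtain ⟨h3, h4⟩ := h (m 1) (-l 1) (by
      ext i
      fin_cases i <;> simp
      · linear_combination hd
      · ring)
    obtain ⟨h5, -⟩ := h 1 0 (by
      ext i
      fin_cases i <;> simp
      · simpa using h2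
      · simpa using h4)
    exact one_ne_zero h5
  · intro h s t hst
    have h0 := congrFun hst 0
    have h1 := congrFun hst 1
    simp only [Pi.add_apply, Pi.smul_apply, smul_eq_mul, Pi.zero_apply] at h0 h1
    constructor
    · refine (mul_eq_zero.1 (?_ : s * (l 0 * m 1 - l 1 * m 0) = 0)).resolve_right h
      linear_combination m 1 * h0 - m 0 * h1
    · refine (mul_eq_zero.1 (?_ : t * (l 0 * m 1 - l 1 * m 0) = 0)).resolve_right h
      linear_combination l 0 * h1 - l 1 * h0

theorem smul_cubeProd (c : ℂ) (l m : Fin 2 → ℂ) :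
    c • cubeProd l m = cubeProd l (c • m) := by
  apply form_injective
  simp only [form_smul, form_cubeProd, linForm_eq, Pi.smul_apply, smul_eq_mul, map_mul]
  ring

theorem exists_smul_squareProd (c : ℂ) :
    ∃ s : ℂ, s ^ 2 = c ∧ ∀ l m, c • squareProd l m = squareProd (s • l) m := by
  obtain ⟨s, hs⟩ := IsAlgClosed.exists_pow_nat_eq c (n := 2) (by norm_num)
  refine ⟨s, hs, fun l m => ?_⟩
  apply form_injective
  simp only [form_smul, form_squareProd, linForm_eq, Pi.smul_apply, smul_eq_mul, map_mul, ← hs,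
    map_pow]
  ring

theorem squareProd_eq_cubeProd {l m : Fin 2 → ℂ} (h : ¬ LinearIndependent ℂ ![l, m]) :
    ∃ l' m', squareProd l m = cubeProd l' m' := by
  by_cases hl : l = 0
  · subst hl
    refine ⟨0, 0, ?_⟩
    simp [squareProd, cubeProd]
  · rw [LinearIndependent.pair_iff' hl] at h
    push Not at h
    obtain ⟨c, rfl⟩ := h
    refine ⟨l, c ^ 2 • l, form_injective ?_⟩
    simp only [form_squareProd, form_cubeProd, linForm_eq, Pi.smul_apply, smul_eq_mul, map_mul,
      map_pow]
    ring

theorem eval_invQ_squareProd (l m : Fin 2 → ℂ) :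
    eval (squareProd l m) invQ = (l 0 * m 1 - l 1 * m 0) ^ 4 / 12 := by
  rw [eval_invQ]
  simp only [squareProd, Matrix.cons_val]
  ring

theorem veronese_eq (v : Fin 2 → ℂ) : veronese v = cubeProd v v := by
  apply form_injective
  rw [veronese, form_coords (by simpa using (linForm_isHomogeneous v).pow 4), form_cubeProd]
  ring

theorem hasDerivAt_veronese (v w : Fin 2 → ℂ) :
    HasDerivAt (fun s : ℂ => veronese (v + s • w)) ((4 : ℂ) • cubeProd v w) 0 := by
  have hd (i : Fin 2) : HasDerivAt (fun s : ℂ => v i + s * w i) (w i) 0 := by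
    simpa using ((hasDerivAt_id (0 : ℂ)).mul_const (w i)).const_add (v i)
  have e : (fun s : ℂ => veronese (v + s • w)) = fun s => ![(v 0 + s * w 0) ^ 4,
      (v 0 + s * w 0) ^ 3 * (v 1 + s * w 1), (v 0 + s * w 0) ^ 2 * (v 1 + s * w 1) ^ 2,
      (v 0 + s * w 0) * (v 1 + s * w 1) ^ 3, (v 1 + s * w 1) ^ 4] := by
    funext s
    rw [veronese_eq]
    ext i
    fin_cases i <;> simp [cubeProd] <;> ring
  rw [e]
  refine hasDerivAt_pi.2 fun i => ?_
  fin_cases i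
  · refine ((hd 0).pow 4).congr_deriv ?_
    simp [cubeProd]
    ring
  · refine (((hd 0).pow 3).fun_mul (hd 1)).congr_deriv ?_
    simp [cubeProd]
    ring
  · refine (((hd 0).pow 2).fun_mul ((hd 1).pow 2)).congr_deriv ?_
    simp [cubeProd]
    ring
  · refine ((hd 0).fun_mul ((hd 1).pow 3)).congr_deriv ?_
    simp [cubeProd]
    ring
  · refine ((hd 1).pow 4).congr_deriv ?_
    simp [cubeProd]
    ring

/-- The derivative of v⁴ in the direction w is 4v³w, so tangent lines consist of quartics with a
triple root. -/
theorem mem_tangentialSurface_iff {x : P4} :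
    x ∈ tangentialSurface ↔ ∃ l m, x.rep = cubeProd l m := by
  simp only [tangentialSurface, Set.mem_iUnion]
  constructor
  · rintro ⟨v, -, w, h⟩
    refine ⟨v, (4 : ℂ) • w, ?_⟩
    rw [← smul_cubeProd]
    exact h.unique (hasDerivAt_veronese v w)
  · rintro ⟨l, m, h⟩
    refine ⟨l, ?_, (4⁻¹ : ℂ) • m, ?_⟩
    · rintro rfl
      exact x.rep_ne_zero (by rw [h]; simp [cubeProd])
    · have := hasDerivAt_veronese l ((4⁻¹ : ℂ) • m)
      rwa [smul_cubeProd, smul_inv_smul₀ (by norm_num), ← h] at this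

theorem mem_twoDoubleRoots_iff {x : P4} : x ∈ twoDoubleRoots ↔
    ∃ l m, LinearIndependent ℂ ![l, m] ∧ x.rep = squareProd l m := by
  refine exists₂_congr fun l m => and_congr_right fun _ => ?_
  rw [← form_squareProd, form_injective.eq_iff]

/-- A quartic on which both invariants vanish has a triple root. -/
theorem exists_cubeProd_of_invariants_eq_zero {a : V5} (hQ : eval a invQ = 0)
    (hC : eval a invC = 0) : ∃ l m, a = cubeProd l m := by
  rcases square_or_weierstrass a with ⟨l, m, h⟩ | ⟨g, p, r, h⟩
  · rw [← form_squareProd, form_injective.eq_iff] at h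
    have hlm : ¬ LinearIndependent ℂ ![l, m] := by
      rw [linearIndependent_pair_iff, not_not]
      rw [h, eval_invQ_squareProd] at hQ
      simpa using hQ
    rw [h]
    exact squareProd_eq_cubeProd hlm
  · have h1 := eval_invQ_act g a
    have h2 := eval_invC_act g a
    rw [hQ, h, eval_invQ_weierstrass, mul_zero] at h1
    rw [hC, h, eval_invC_weierstrass, mul_zero] at h2
    have hp : p = 0 := by simpa using h1
    have hr : r = 0 := by simpa using h2
    have e : weierstrass p r = cubeProd ![1, 0] ![0, 4] := by
      simp [weierstrass, cubeProd, hp, hr]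
    rw [← act_inv_act g a, h, e, act_cubeProd]
    exact ⟨_, _, rfl⟩

theorem tangentialSurface_eq :
    tangentialSurface = {x | eval x.rep invQ = 0} ∩ {x | eval x.rep invC = 0} := by
  ext x
  rw [mem_tangentialSurface_iff]
  refine ⟨?_, fun h => exists_cubeProd_of_invariants_eq_zero h.1 h.2⟩
  rintro ⟨l, m, h⟩
  exact ⟨by simp [h, eval_invQ_cubeProd], by simp [h, eval_invC_cubeProd]⟩

theorem isClosed_tangentialSurface : IsClosed tangentialSurface := by
  rw [tangentialSurface_eq]
  exact (isClosed_zeros invQ_isHomogeneous).inter (isClosed_zeros invC_isHomogeneous)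

/-- The set of quartics that are squares of quadratic forms. -/
def squares : Set P4 := {x | ∃ l m, x.rep = squareProd l m}

theorem mem_omega_zeros_of_apply {x : P4} (h : ∀ v, omega.apply x.rep v = 0) :
    x ∈ omega.zeros := by
  by_contra hx
  obtain ⟨v, hv⟩ := exists_eval_omega_ne_zero_iff.1
    (show ∃ i, eval x.rep (omega i) ≠ 0 by simpa [OneForm.zeros] using hx)
  exact hv (h v)

theorem squares_subset_zeros : squares ⊆ omega.zeros := by
  rintro x ⟨l, m, h⟩
  exact mem_omega_zeros_of_apply fun v => by rw [h, omega_squareProd]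

theorem tangentialSurface_subset_zeros : tangentialSurface ⊆ omega.zeros := by
  intro x hx
  obtain ⟨l, m, h⟩ := mem_tangentialSurface_iff.1 hx
  exact mem_omega_zeros_of_apply fun v => by rw [h, omega_cubeProd]

/-- In the normal form the fifth and fourth coefficients of ω force p = 0 and r = 0, hence Q = C =
0. -/
theorem zeros_subset_union_squares : omega.zeros ⊆ tangentialSurface ∪ squares := by
  intro x hx
  rcases square_or_weierstrass x.rep with ⟨l, m, h⟩ | ⟨g, p, r, h⟩
  · rw [← form_squareProd, form_injective.eq_iff] at h
    exact Or.inr ⟨l, m, h⟩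
  · left
    have hv (v : V5) : omega.apply (weierstrass p r) v = 0 := by
      rw [← h, ← act_act_inv g v, omega_act]
      have : omega.apply x.rep (act (g⁻¹ : GL (Fin 2) ℂ) v) = 0 := by
        unfold OneForm.apply
        exact Finset.sum_eq_zero fun i _ => by rw [hx i, zero_mul]
      rw [this, mul_zero]
    have h4 := hv (Pi.single 4 1)
    have h3 := hv (Pi.single 3 1)
    rw [omega_weierstrass] at h3 h4
    have hp : p = 0 := by simpa using h4
    have hr : r = 0 := by simpa using h3
    rw [tangentialSurface_eq]
    have h1 := eval_invQ_act g x.rep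
    have h2 := eval_invC_act g x.rep
    rw [h, eval_invQ_weierstrass, hp] at h1
    rw [h, eval_invC_weierstrass, hr] at h2
    have hd := det_ne_zero g
    constructor
    · simpa [hd] using h1.symm
    · simpa [hd] using h2.symm

theorem twoDoubleRoots_subset_squares : twoDoubleRoots ⊆ squares := by
  intro x hx
  obtain ⟨l, m, -, h⟩ := mem_twoDoubleRoots_iff.1 hx
  exact ⟨l, m, h⟩

/-- A square with dependent factors is a fourth power up to a scalar, so it lies on the tangential
surface. This lets the squares, which have a polynomial parametrization, stand in for N. -/
theorem squares_subset_union : squares ⊆ tangentialSurface ∪ twoDoubleRoots := by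
  rintro x ⟨l, m, h⟩
  by_cases hlm : LinearIndependent ℂ ![l, m]
  · exact Or.inr (mem_twoDoubleRoots_iff.2 ⟨l, m, hlm, h⟩)
  · obtain ⟨l', m', h'⟩ := squareProd_eq_cubeProd hlm
    exact Or.inl (mem_tangentialSurface_iff.2 ⟨l', m', h.trans h'⟩)

theorem zeros_eq : omega.zeros = tangentialSurface ∪ closure twoDoubleRoots := by
  refine Set.Subset.antisymm ?_ (Set.union_subset tangentialSurface_subset_zeros
    (closure_minimal (twoDoubleRoots_subset_squares.trans squares_subset_zeros)
      isClosed_omega_zeros))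
  refine zeros_subset_union_squares.trans (Set.union_subset Set.subset_union_left ?_)
  exact squares_subset_union.trans (Set.union_subset_union_right _ subset_closure)

theorem exists_twoDoubleRoots_eq_orbit : ∃ x : P4, twoDoubleRoots = orbit x := by
  let a : V5 := squareProd ![1, 0] ![0, 1]
  have ha : a ≠ 0 := fun h => by
    have := congrFun h 2
    simp [a, squareProd] at this
  refine ⟨P4.mk a ha, ?_⟩
  ext y
  rw [mem_twoDoubleRoots_iff, ← P4.mk_rep y, mk_mem_orbit_mk_iff, P4.mk_rep]
  constructor
  · rintro ⟨l, m, hlm, h⟩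
    -- The columns are l and m, so t₀²t₁² is sent to l²m².
    let M : Matrix (Fin 2) (Fin 2) ℂ := !![l 0, m 0; l 1, m 1]
    have hM : M.det ≠ 0 := by
      rw [linearIndependent_pair_iff] at hlm
      simp only [M, Matrix.det_fin_two_of]
      convert hlm using 1
      ring
    refine ⟨Matrix.GeneralLinearGroup.mkOfDetNeZero M hM, 1, one_ne_zero, ?_⟩
    change act M a = _
    rw [act_squareProd, one_smul, h]
    congr 1
    · ext i; fin_cases i <;> simp [M]
    · ext i; fin_cases i <;> simp [M]
  · rintro ⟨g, c, hc, h⟩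
    obtain ⟨s, hs, hsq⟩ := exists_smul_squareProd c⁻¹
    have hs0 : s ≠ 0 := by
      rintro rfl
      exact inv_ne_zero hc (by rw [← hs]; simp)
    rw [act_squareProd] at h
    have e : y.rep = c⁻¹ • c • y.rep := (inv_smul_smul₀ hc _).symm
    rw [← h, hsq] at e
    refine ⟨_, _, ?_, e⟩
    rw [linearIndependent_pair_iff]
    have hd := det_ne_zero g
    rw [Matrix.det_fin_two] at hd
    convert mul_ne_zero hs0 hd using 1
    simp [Matrix.mulVec, dotProduct, Fin.sum_univ_two]
    ring

/-! ### The codimension of the components of the zero set -/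

theorem isIrreducible_tangentialSurface : IsIrreducible tangentialSurface := by
  let φ : Fin 5 → MvPolynomial (Fin 4) ℂ :=
    ![X 0 ^ 3 * X 2, C (1 / 4) * (C 3 * X 0 ^ 2 * X 1 * X 2 + X 0 ^ 3 * X 3),
      C (1 / 2) * (X 0 * X 1 ^ 2 * X 2 + X 0 ^ 2 * X 1 * X 3),
      C (1 / 4) * (X 1 ^ 3 * X 2 + C 3 * X 0 * X 1 ^ 2 * X 3), X 1 ^ 3 * X 3]
  have hφ (p : Fin 4 → ℂ) : (fun i => eval p (φ i)) = cubeProd ![p 0, p 1] ![p 2, p 3] := by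
    ext i
    fin_cases i <;> simp [φ, cubeProd] <;> ring
  refine isIrreducible_of_parametrization ?_ φ (fun x hx => ?_) (fun p hp => ?_)
  · have h : cubeProd ![1, 0] ![1, 0] ≠ 0 := fun h => by simpa [cubeProd] using congrFun h 0
    obtain ⟨c, hc, e⟩ := P4.exists_rep_mk h
    rw [smul_cubeProd] at e
    exact ⟨P4.mk _ h, mem_tangentialSurface_iff.2 ⟨_, _, e⟩⟩
  · obtain ⟨l, m, h⟩ := mem_tangentialSurface_iff.1 hx
    refine ⟨![l 0, l 1, m 0, m 1], ?_⟩
    rw [hφ, h]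
    simp [cubeProd]
  · obtain ⟨c, hc, e⟩ := P4.exists_rep_mk hp
    exact mem_tangentialSurface_iff.2
      ⟨_, _, e.trans ((congrArg (c • ·) (hφ p)).trans (smul_cubeProd _ _ _))⟩

theorem isIrreducible_squares : IsIrreducible squares := by
  let φ : Fin 5 → MvPolynomial (Fin 4) ℂ :=
    ![X 0 ^ 2 * X 2 ^ 2, C (1 / 2) * (X 0 * X 1 * X 2 ^ 2 + X 0 ^ 2 * X 2 * X 3),
      C (1 / 6) * (X 0 ^ 2 * X 3 ^ 2 + C 4 * X 0 * X 1 * X 2 * X 3 + X 1 ^ 2 * X 2 ^ 2),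
      C (1 / 2) * (X 0 * X 1 * X 3 ^ 2 + X 1 ^ 2 * X 2 * X 3), X 1 ^ 2 * X 3 ^ 2]
  have hφ (p : Fin 4 → ℂ) : (fun i => eval p (φ i)) = squareProd ![p 0, p 1] ![p 2, p 3] := by
    ext i
    fin_cases i <;> simp [φ, squareProd] <;> ring
  refine isIrreducible_of_parametrization ?_ φ (fun x hx => ?_) (fun p hp => ?_)
  · have h : squareProd ![1, 0] ![1, 0] ≠ 0 := fun h => by simpa [squareProd] using congrFun h 0
    obtain ⟨c, hc, e⟩ := P4.exists_rep_mk h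
    obtain ⟨s, -, hs⟩ := exists_smul_squareProd c
    rw [hs] at e
    exact ⟨P4.mk _ h, _, _, e⟩
  · obtain ⟨l, m, h⟩ := hx
    refine ⟨![l 0, l 1, m 0, m 1], ?_⟩
    rw [hφ, h]
    simp [squareProd]
  · obtain ⟨c, hc, e⟩ := P4.exists_rep_mk hp
    obtain ⟨s, -, hs⟩ := exists_smul_squareProd c
    exact ⟨_, _, e.trans ((congrArg (c • ·) (hφ p)).trans (hs _ _))⟩

/-! ### Lower bound for the codimension, through the discriminant hypersurface. -/

theorem isIrreducible_univ_P4 : IsIrreducible (Set.univ : Set P4) := by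
  refine isIrreducible_of_parametrization ?_ X (fun x _ => ⟨x.rep, by simp⟩)
    (fun p hp => Set.mem_univ _)
  have h : weierstrass 0 0 ≠ 0 := fun h => by simpa [weierstrass] using congrFun h 1
  exact ⟨P4.mk _ h, trivial⟩

/-- The coordinates of the quartic `(l₀ t₀ + l₁ t₁)² (q₀ t₀² + q₁ t₀ t₁ + q₂ t₁²)`. -/
noncomputable def doubleRootProd (l : Fin 2 → ℂ) (q : Fin 3 → ℂ) : V5 :=
  ![l 0 ^ 2 * q 0, (2 * l 0 * l 1 * q 0 + l 0 ^ 2 * q 1) / 4,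
    (l 1 ^ 2 * q 0 + 2 * l 0 * l 1 * q 1 + l 0 ^ 2 * q 2) / 6,
    (l 1 ^ 2 * q 1 + 2 * l 0 * l 1 * q 2) / 4, l 1 ^ 2 * q 2]

theorem smul_doubleRootProd (c : ℂ) (l : Fin 2 → ℂ) (q : Fin 3 → ℂ) :
    c • doubleRootProd l q = doubleRootProd l (c • q) := by
  ext i
  fin_cases i <;> simp [doubleRootProd] <;> ring

/-- The set of quartics with a multiple root. -/
def multipleRoot : Set P4 := {x | ∃ l q, x.rep = doubleRootProd l q}

/-- The closure of this set is the middle term of the chain. The parametrization avoids proving that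
the discriminant is an irreducible polynomial. -/
theorem isIrreducible_multipleRoot : IsIrreducible multipleRoot := by
  let φ : Fin 5 → MvPolynomial (Fin 5) ℂ :=
    ![X 0 ^ 2 * X 2, C (1 / 4) * (C 2 * X 0 * X 1 * X 2 + X 0 ^ 2 * X 3),
      C (1 / 6) * (X 1 ^ 2 * X 2 + C 2 * X 0 * X 1 * X 3 + X 0 ^ 2 * X 4),
      C (1 / 4) * (X 1 ^ 2 * X 3 + C 2 * X 0 * X 1 * X 4), X 1 ^ 2 * X 4]
  have hφ (p : Fin 5 → ℂ) :
      (fun i => eval p (φ i)) = doubleRootProd ![p 0, p 1] ![p 2, p 3, p 4] := by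
    ext i
    fin_cases i <;> simp [φ, doubleRootProd] <;> ring
  refine isIrreducible_of_parametrization ?_ φ (fun x hx => ?_) (fun p hp => ?_)
  · have h : doubleRootProd ![1, 0] ![1, 0, 0] ≠ 0 := fun h => by
      simpa [doubleRootProd] using congrFun h 0
    obtain ⟨c, hc, e⟩ := P4.exists_rep_mk h
    rw [smul_doubleRootProd] at e
    exact ⟨P4.mk _ h, _, _, e⟩
  · obtain ⟨l, q, h⟩ := hx
    refine ⟨![l 0, l 1, q 0, q 1, q 2], ?_⟩
    rw [hφ, h]
    simp [doubleRootProd]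
  · obtain ⟨c, hc, e⟩ := P4.exists_rep_mk hp
    exact ⟨_, _, e.trans ((congrArg (c • ·) (hφ p)).trans (smul_doubleRootProd _ _ _))⟩

/-- The discriminant of a binary quartic, up to a constant factor. -/
noncomputable def disc : MvPolynomial (Fin 5) ℂ := invQ ^ 3 - C 27 * invC ^ 2

theorem disc_isHomogeneous : disc.IsHomogeneous 6 := by
  have := (invQ_isHomogeneous.pow 3).sub
    ((isHomogeneous_C (Fin 5) (27 : ℂ)).mul (invC_isHomogeneous.pow 2))
  simpa [disc] using this

theorem eval_disc (a : V5) : eval a disc = eval a invQ ^ 3 - 27 * eval a invC ^ 2 := by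
  simp [disc]

theorem closure_multipleRoot_subset : closure multipleRoot ⊆ {x | eval x.rep disc = 0} := by
  refine closure_minimal ?_ (isClosed_zeros disc_isHomogeneous)
  rintro x ⟨l, q, h⟩
  change eval x.rep disc = 0
  rw [h, eval_disc, eval_invQ, eval_invC]
  simp only [doubleRootProd, Matrix.cons_val]
  ring

theorem tangentialSurface_subset_multipleRoot : tangentialSurface ⊆ multipleRoot := by
  intro x hx
  obtain ⟨l, m, h⟩ := mem_tangentialSurface_iff.1 hx
  refine ⟨l, ![l 0 * m 0, l 0 * m 1 + l 1 * m 0, l 1 * m 1], ?_⟩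
  rw [h]
  ext i
  fin_cases i <;> simp [doubleRootProd, cubeProd] <;> ring

theorem squares_subset_multipleRoot : squares ⊆ multipleRoot := by
  rintro x ⟨l, m, h⟩
  refine ⟨l, ![m 0 ^ 2, 2 * m 0 * m 1, m 1 ^ 2], ?_⟩
  rw [h]
  ext i
  fin_cases i <;> simp [doubleRootProd, squareProd] <;> ring

theorem not_multipleRoot_subset_zeros : ¬ multipleRoot ⊆ omega.zeros := by
  intro h
  -- The quartic (t₀ - t₁)²(4t₀t₁ + 8t₁²) has one double and two simple roots and is already in
  -- normal form, with p = -3.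
  let a : V5 := doubleRootProd ![1, -1] ![0, 4, 8]
  have e : a = weierstrass (-3) 8 := by
    ext i
    fin_cases i <;> simp [a, doubleRootProd, weierstrass] <;> norm_num
  have ha : a ≠ 0 := fun h => by simpa [e, weierstrass] using congrFun h 1
  obtain ⟨c, hc, hr⟩ := P4.exists_rep_mk ha
  have hz := h (show P4.mk a ha ∈ multipleRoot from ⟨_, _, hr.trans (smul_doubleRootProd _ _ _)⟩) 4
  rw [eval_rep_mk_eq_zero_iff (omega_isHomogeneous 4)] at hz
  have := omega_weierstrass (-3) 8 (Pi.single 4 1)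
  rw [← e] at this
  simp [OneForm.apply, Pi.single_apply, hz] at this

theorem closure_multipleRoot_ne_univ : closure multipleRoot ≠ Set.univ := by
  intro h
  have ha : weierstrass 1 0 ≠ 0 := fun h => by simpa [weierstrass] using congrFun h 1
  have hz := closure_multipleRoot_subset (h ▸ Set.mem_univ (P4.mk _ ha))
  have hz' := (eval_rep_mk_eq_zero_iff disc_isHomogeneous ha).1 hz
  rw [eval_disc, eval_invQ_weierstrass, eval_invC_weierstrass] at hz'
  norm_num at hz'

/-- The chain is Z ⊂ closure of `multipleRoot` ⊂ P⁴. The first inclusion is strict because ω is not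
identically zero on the discriminant. -/
theorem two_le_coheight (Z : TopologicalSpace.IrreducibleCloseds P4)
    (h1 : (Z : Set P4) ⊆ closure multipleRoot) (h2 : (Z : Set P4) ⊆ omega.zeros) :
    2 ≤ Order.coheight Z := by
  let Y : TopologicalSpace.IrreducibleCloseds P4 :=
    ⟨closure multipleRoot, isIrreducible_multipleRoot.closure, isClosed_closure⟩
  let T : TopologicalSpace.IrreducibleCloseds P4 :=
    ⟨Set.univ, isIrreducible_univ_P4, isClosed_univ⟩
  have hZY : Z < Y := by
    refine SetLike.coe_ssubset_coe.1 ⟨h1, fun h => not_multipleRoot_subset_zeros ?_⟩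
    exact subset_closure.trans (h.trans h2)
  have hYT : Y < T := SetLike.coe_ssubset_coe.1
    ((Set.ssubset_univ_iff).2 closure_multipleRoot_ne_univ)
  calc (2 : ℕ∞) = 0 + 1 + 1 := by norm_num
    _ ≤ Order.coheight T + 1 + 1 := by gcongr; exact zero_le
    _ ≤ Order.coheight Y + 1 := by gcongr; exact Order.coheight_add_one_le hYT
    _ ≤ Order.coheight Z := Order.coheight_add_one_le hZY

/-! ### Upper bound for the codimension: two equations for each family. -/

theorem X_zero_notMem_vanishingIdeal {S : Set P4} {a : V5} (ha : a ∈ cone S) (h : a 0 ≠ 0) :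
    X 0 ∉ vanishingIdeal ℂ (cone S) := fun h0 =>
  h (by simpa using mem_vanishingIdeal_cone_iff.1 h0 a ha)

theorem coheight_tangentialSurface : Order.coheight (⟨tangentialSurface,
    isIrreducible_tangentialSurface, isClosed_tangentialSurface⟩ :
      TopologicalSpace.IrreducibleCloseds P4) = 2 := by
  refine le_antisymm (coheight_le_two _ (f := invQ) (g := invC) (u := X 0) ?_ ?_ ?_ ?_)
    (two_le_coheight _ (tangentialSurface_subset_multipleRoot.trans subset_closure)
      tangentialSurface_subset_zeros)
  · rw [mem_vanishingIdeal_cone_iff_of_isHomogeneous invQ_isHomogeneous]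
    change tangentialSurface ⊆ _
    rw [tangentialSurface_eq]
    exact Set.inter_subset_left
  · rw [mem_vanishingIdeal_cone_iff_of_isHomogeneous invC_isHomogeneous]
    change tangentialSurface ⊆ _
    rw [tangentialSurface_eq]
    exact Set.inter_subset_right
  · have h : cubeProd ![1, 0] ![1, 0] ≠ 0 := fun h => by simpa [cubeProd] using congrFun h 0
    obtain ⟨c, hc, e⟩ := P4.exists_rep_mk h
    rw [smul_cubeProd] at e
    refine X_zero_notMem_vanishingIdeal
      ⟨h, mem_tangentialSurface_iff.2 ⟨_, _, e⟩⟩ ?_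
    simp [cubeProd]
  · intro a hQ hC h0
    have ha : a ≠ 0 := by
      rintro rfl
      simp at h0
    refine ⟨ha, ?_⟩
    change P4.mk a ha ∈ tangentialSurface
    rw [tangentialSurface_eq]
    exact ⟨(eval_rep_mk_eq_zero_iff invQ_isHomogeneous ha).2 hQ,
      (eval_rep_mk_eq_zero_iff invC_isHomogeneous ha).2 hC⟩

/-- The coefficient of `t₀ t₁³` in the condition that a quartic is a square. -/
noncomputable def squareEqCubic : MvPolynomial (Fin 5) ℂ :=
  X 0 ^ 2 * X 3 - C 3 * X 0 * X 1 * X 2 + C 2 * X 1 ^ 3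

/-- The coefficient of `t₁⁴` in the condition that a quartic is a square. -/
noncomputable def squareEqQuartic : MvPolynomial (Fin 5) ℂ :=
  X 0 ^ 3 * X 4 - (C 3 * X 0 * X 2 - C 2 * X 1 ^ 2) ^ 2

theorem squareEqCubic_isHomogeneous : squareEqCubic.IsHomogeneous 3 := by
  have hX (i : Fin 5) : (X i : MvPolynomial (Fin 5) ℂ).IsHomogeneous 1 := isHomogeneous_X ℂ i
  have hC (c : ℂ) : (C c : MvPolynomial (Fin 5) ℂ).IsHomogeneous 0 := isHomogeneous_C _ _
  have := ((((hX 0).pow 2).mul (hX 3)).sub ((((hC 3).mul (hX 0)).mul (hX 1)).mul (hX 2))).add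
    ((hC 2).mul ((hX 1).pow 3))
  simpa [squareEqCubic] using this

theorem squareEqQuartic_isHomogeneous : squareEqQuartic.IsHomogeneous 4 := by
  have hX (i : Fin 5) : (X i : MvPolynomial (Fin 5) ℂ).IsHomogeneous 1 := isHomogeneous_X ℂ i
  have hC (c : ℂ) : (C c : MvPolynomial (Fin 5) ℂ).IsHomogeneous 0 := isHomogeneous_C _ _
  have := (((hX 0).pow 3).mul (hX 4)).sub
    (((((hC 3).mul (hX 0)).mul (hX 2)).sub ((hC 2).mul ((hX 1).pow 2))).pow 2)
  simpa [squareEqQuartic] using this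

/-- A square with a₀ ≠ 0 is a₀(t₀² + 2b t₀t₁ + c t₁²)². The coordinates a₀, a₁, a₂ determine b and
c, and the two equations say that a₃ and a₄ agree. With d² = b² - c the quadratic factors as (t₀ +
(b + d)t₁)(t₀ + (b - d)t₁). -/
theorem exists_squareProd_of_equations {a : V5} (h0 : a 0 ≠ 0) (h1 : eval a squareEqCubic = 0)
    (h2 : eval a squareEqQuartic = 0) : ∃ l m, a = squareProd l m := by
  simp only [squareEqCubic, squareEqQuartic, map_add, map_sub, map_mul, map_pow, eval_X, eval_C]
    at h1 h2
  obtain ⟨s, hs⟩ := IsAlgClosed.exists_pow_nat_eq (a 0) (n := 2) (by norm_num)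
  let b := a 1 / a 0
  let c := (3 * a 0 * a 2 - 2 * a 1 ^ 2) / a 0 ^ 2
  obtain ⟨d, hd⟩ := IsAlgClosed.exists_pow_nat_eq (b ^ 2 - c) (n := 2) (by norm_num)
  have e1 : a 1 = a 0 * b := by simp only [b]; field_simp
  have e2 : a 2 = a 0 * (2 * b ^ 2 + c) / 3 := by simp only [b, c]; field_simp; ring
  have e3 : a 3 = a 0 * b * c := by
    simp only [b, c]; field_simp; linear_combination h1
  have e4 : a 4 = a 0 * c ^ 2 := by
    simp only [c]; field_simp; linear_combination h2
  have hc : c = b ^ 2 - d ^ 2 := by rw [hd]; ring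
  refine ⟨![s, s * (b + d)], ![1, b - d], ?_⟩
  ext i
  fin_cases i <;> simp [squareProd, e1, e2, e3, e4, hc, ← hs] <;> ring

theorem coheight_closure_squares : Order.coheight (⟨closure squares,
    isIrreducible_squares.closure, isClosed_closure⟩ :
      TopologicalSpace.IrreducibleCloseds P4) = 2 := by
  refine le_antisymm
    (coheight_le_two _ (f := squareEqCubic) (g := squareEqQuartic) (u := X 0) ?_ ?_ ?_ ?_)
    (two_le_coheight _ (closure_mono squares_subset_multipleRoot)
      (closure_minimal squares_subset_zeros isClosed_omega_zeros))
  · rw [mem_vanishingIdeal_cone_iff_of_isHomogeneous squareEqCubic_isHomogeneous]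
    refine closure_minimal ?_ (isClosed_zeros squareEqCubic_isHomogeneous)
    rintro x ⟨l, m, h⟩
    change eval x.rep _ = 0
    simp [h, squareEqCubic, squareProd]
    ring
  · rw [mem_vanishingIdeal_cone_iff_of_isHomogeneous squareEqQuartic_isHomogeneous]
    refine closure_minimal ?_ (isClosed_zeros squareEqQuartic_isHomogeneous)
    rintro x ⟨l, m, h⟩
    change eval x.rep _ = 0
    simp [h, squareEqQuartic, squareProd]
    ring
  · have h : squareProd ![1, 0] ![1, 0] ≠ 0 := fun h => by simpa [squareProd] using congrFun h 0
    obtain ⟨c, hc, e⟩ := P4.exists_rep_mk h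
    obtain ⟨s, -, hs⟩ := exists_smul_squareProd c
    rw [hs] at e
    refine X_zero_notMem_vanishingIdeal ⟨h, subset_closure ⟨_, _, e⟩⟩ ?_
    simp [squareProd]
  · intro a h1 h2 h0
    rw [eval_X] at h0
    have ha : a ≠ 0 := by
      rintro rfl
      simp at h0
    obtain ⟨l, m, h⟩ := exists_squareProd_of_equations h0 h1 h2
    obtain ⟨c, hc, e⟩ := P4.exists_rep_mk ha
    obtain ⟨s, -, hs⟩ := exists_smul_squareProd c
    refine ⟨ha, subset_closure ⟨s • l, m, ?_⟩⟩
    rw [e, ← hs, ← h]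

/-- An irreducible set inside the union of two closed sets lies in one of them, and by maximality it
equals that one. -/
theorem coheight_eq_two_of_maximal {Z : TopologicalSpace.IrreducibleCloseds P4}
    (hZ : Maximal (fun Y : TopologicalSpace.IrreducibleCloseds P4 => (Y : Set P4) ⊆ omega.zeros)
      Z) : Order.coheight Z = 2 := by
  have hsub : (Z : Set P4) ⊆ tangentialSurface ∪ closure squares :=
    hZ.1.trans (zeros_subset_union_squares.trans
      (Set.union_subset_union_right _ subset_closure))
  rcases isPreirreducible_iff_isClosed_union_isClosed.1 Z.isIrreducible.isPreirreducible _ _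
    isClosed_tangentialSurface isClosed_closure hsub with h | h
  · rw [← coheight_tangentialSurface]
    congr 1
    exact le_antisymm h (hZ.2 tangentialSurface_subset_zeros h)
  · rw [← coheight_closure_squares]
    congr 1
    exact le_antisymm h
      (hZ.2 (closure_minimal squares_subset_zeros isClosed_omega_zeros) h)

theorem omega_ne_zero : omega ≠ 0 := by
  intro h
  have := omega_weierstrass 1 0 (Pi.single 4 1)
  rw [h] at this
  simp [OneForm.apply] at this

end BinaryQuartic

open BinaryQuartic in
theorem mainTheorem2 :
    -- the one-form descends to the projective space, is nonzero, and is integrable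
    (omega.IsProjective 3 ∧ omega ≠ 0 ∧ omega.IsIntegrable) ∧
    -- away from its zeros it defines the foliation whose leaves are the orbits
    (∀ x : P4, x ∉ omega.zeros →
      {v : V5 | omega.apply x.rep v = 0} = orbitTangent x.rep ∧ omega.leaf x = orbit x) ∧
    -- the quartics with two double roots form one orbit
    (∃ x : P4, twoDoubleRoots = orbit x) ∧
    -- the zero set
    omega.zeros = tangentialSurface ∪ closure twoDoubleRoots ∧
    -- every irreducible component of the zero set has codimension two
    (∀ Z : TopologicalSpace.IrreducibleCloseds P4,
      Maximal (fun Y : TopologicalSpace.IrreducibleCloseds P4 => (Y : Set P4) ⊆ omega.zeros) Z →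
        Order.coheight Z = 2) := by
  refine ⟨⟨omega_isProjective, omega_ne_zero, omega_isIntegrable⟩, fun x hx => ⟨?_, ?_⟩,
    exists_twoDoubleRoots_eq_orbit, zeros_eq, fun Z hZ => coheight_eq_two_of_maximal hZ⟩
  · exact ker_omega_eq_orbitTangent (by simpa [OneForm.zeros] using hx)
  · exact (leaf_subset_orbit x).antisymm (orbit_subset_leaf hx)
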